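/- For an $n\times n$ complex positive definite matrix $A$, an $n\times n$ positive semidefinite matrix $B$ and $k,t\in(0,1)$, let $$A\#_t B=A^{1/2}\bigl(A^{-1/2}BA^{-1/2}\bigr)^tA^{1/2},\qquad F_{k,t}(A,B)=(A^{-1}\#_kB)^t\,A^{1+2t-4kt}\,(A^{-1}\#_kB)^t .$$ For positive semidefinite $X,Y$ with eigenvalues $\lambda_1(X)\ge\dots\ge\lambda_n(X)$ and $\lambda_1(Y)\ge\dots\ge\lambda_n(Y)$ (counted with multiplicity), write $X\prec_{(\log)}Y$ if $\prod_{i=1}^j\lambda_i(X)\le\prod_{i=1}^j\lambda_i(Y)$ for $j=1,\dots,n$, with equality for $j=n$, i.e. $\det X=\det Y$. **Theorem.** Let $A,B$ be $n\times n$ complex positive definite matrices. (1) If $k,t\in(0,\tfrac12]$, then for all $p>0$ $$\begin{aligned} A\#_{2kt}B&\prec_{(\log)}\exp\bigl[(1-2kt)\log A+2kt\log B\bigr]\\ &\prec_{(\log)}\Bigl(A^{\frac{(1-2kt)p}{2}}B^{2ktp}A^{\frac{(1-2kt)p}{2}}\Bigr)^{\frac1p} \prec_{(\log)}\Bigl(A^{\frac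 p2}B^{\frac{2ktp}{1-2kt}}A^{\frac p2}\Bigr)^{\frac{1-2kt}{p}}\\ &\prec_{(\log)}F_{k,t}(A^p,B^p)^{\frac1p} \prec_{(\log)}\Bigl(A^{\frac{(1-2kt)p}{4kt}}B^pA^{\frac{(1-2kt)p}{4kt}}\Bigr)^{\frac{2kt}{p}}. \end{aligned}$$ (2) If $k,t\in[\tfrac12,1)$, then, with $s=2(1-k)(1-t)$, for all $p>0$ $$\begin{aligned} B\#_{s}A&\prec_{(\log)}\exp\bigl[s\log A+(1-s)\log B\bigr]\\ &\prec_{(\log)}\Bigl(A^{\frac{sp}{2}}B^{(1-s)p}A^{\frac{sp}{2}}\Bigr)^{\frac1p} \prec_{(\log)}\Bigl(A^{\frac{sp}{2(1-s)}}B^{p}A^{\frac{sp}{2(1-s)}}\Bigr)^{\frac{1-s}{p}}\\ &\prec_{(\log)}F_{1-k,1-t}(B^p,A^p)^{\frac1p} \prec_{(\log)}\Bigl(A^{\frac p2}B^{\frac{(1-s)p}{s}}A^{\frac p2}\Bigr)^{\frac sp}. \end{aligned}$$ -/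

import Mathlib

open scoped ComplexOrder MatrixOrder Matrix.Norms.L2Operator

namespace Matrix

variable {ι : Type*} [Fintype ι] [DecidableEq ι]

/-- The `t`-weighted geometric mean `A #_t B = A^{1/2} (A^{-1/2} B A^{-1/2})^t A^{1/2}`
(intended for `A` positive definite and `B` positive semidefinite). -/
noncomputable def geomMean (t : ℝ) (A B : Matrix ι ι ℂ) : Matrix ι ι ℂ :=
  A ^ (1 / 2 : ℝ) * (A ^ (-(1 / 2) : ℝ) * B * A ^ (-(1 / 2) : ℝ)) ^ t * A ^ (1 / 2 : ℝ)

/-- The `(k, t)`-spectral geometric mean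
`F_{k,t}(A, B) = (A⁻¹ #_k B)^t A^{1 + 2t - 4kt} (A⁻¹ #_k B)^t`. -/
noncomputable def spectralGeomMean (k t : ℝ) (A B : Matrix ι ι ℂ) : Matrix ι ι ℂ :=
  geomMean k A⁻¹ B ^ t * A ^ (1 + 2 * t - 4 * k * t) * geomMean k A⁻¹ B ^ t

/-- Weak log-majorization of positive semidefinite matrices. Here `eigenvalues₀` lists the
eigenvalues with multiplicity in decreasing order, indexed from `0`. -/
def WeakLogMajorizedBy (A B : Matrix ι ι ℂ) : Prop :=
  ∃ (hA : A.PosSemidef) (hB : B.PosSemidef), ∀ j : ℕ, 1 ≤ j → j ≤ Fintype.card ι →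
    (∏ i with i.val < j, hA.isHermitian.eigenvalues₀ i) ≤
      ∏ i with i.val < j, hB.isHermitian.eigenvalues₀ i

/-- Log-majorization: weak log-majorization with equality of the products of all eigenvalues,
that is, equality of determinants. -/
def LogMajorizedBy (A B : Matrix ι ι ℂ) : Prop :=
  WeakLogMajorizedBy A B ∧ A.det = B.det

end Matrix

/-- `A ≺ₗₒ B` : the matrix `A` is log-majorized by `B`. -/
infix:50 " ≺ₗₒ " => Matrix.LogMajorizedBy

/-! ### Real powers of positive definite matrices. -/

namespace Matrix

/-! The norm of the `j`-th compound of a positive semidefinite matrix is the product of its `j`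
largest eigenvalues (`PosSemidef.norm_compound`). Compounds are multiplicative and commute with real
powers, hence with both means. So each log-majorization reduces to an operator norm inequality for
arbitrary positive definite matrices plus a determinant computation.

By homogeneity in `B` (`norm_le_of_homogeneous`), each such inequality reduces to an implication `ψ
≤ 1 → φ ≤ 1`, and these rest on the Löwner–Heinz inequality. Araki's inequality and the upper bound
for `F_{k,t}` follow by taking powers and conjugating. Ando–Hiai comes from `geomMean_sq_le_one`,
and the lower bound for `F_{k,t}` from the grand Furuta inequality `le_conj_rpow`.

The exponential is the Lie–Trotter limit as `p → 0`, both of the geometric means of `A^p`, `B^p` and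
of the Araki expressions. Part (2) is part (1) for `(B, A)` and `(1 - k, 1 - t)`, rewritten using
that `Z Zᴴ` and `Zᴴ Z` have the same eigenvalues. -/

lemma PosDef.nonneg {ι : Type*} {A : Matrix ι ι ℂ} (hA : A.PosDef) : 0 ≤ A :=
  hA.posSemidef.nonneg

variable {ι : Type*} [Fintype ι] [DecidableEq ι]

lemma cfc_unitary_conj (f : ℝ → ℝ) (U : unitary (Matrix ι ι ℂ)) {X : Matrix ι ι ℂ}
    (hX : X.IsHermitian) :
    cfc f ((U : Matrix ι ι ℂ) * X * (star U : Matrix ι ι ℂ)) =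
      (U : Matrix ι ι ℂ) * cfc f X * (star U : Matrix ι ι ℂ) := by
  have hU : Continuous fun x : Matrix ι ι ℂ ↦
      (U : Matrix ι ι ℂ) * x * (star U : Matrix ι ι ℂ) := by fun_prop
  have := StarAlgHomClass.map_cfc (S := ℝ) (Unitary.conjStarAlgAut ℝ (Matrix ι ι ℂ) U) f X
    (X.finite_real_spectrum.continuousOn f) hU hX (IsSelfAdjoint.map hX _)
  simpa using this.symm

lemma cfc_diagonal (f : ℝ → ℝ) (d : ι → ℝ) :
    cfc f (diagonal fun i ↦ (d i : ℂ)) = diagonal fun i ↦ (f (d i) : ℂ) := by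
  set D : Matrix ι ι ℂ := diagonal fun i ↦ (d i : ℂ) with hDdef
  have hD : IsSelfAdjoint D := by
    rw [IsSelfAdjoint, star_eq_conjTranspose, hDdef, diagonal_conjTranspose]
    congr 1; ext i; simp
  -- Including the entries `d i` among the interpolation nodes avoids computing the spectrum of `D`.
  set s : Finset ℝ := D.finite_real_spectrum.toFinset ∪ Finset.univ.image d
  set q : Polynomial ℝ := Lagrange.interpolate s id f
  have hq : ∀ x ∈ s, q.eval x = f x := fun x hx ↦
    Lagrange.eval_interpolate_at_node f Function.injective_id.injOn hx
  have h1 : cfc f D = cfc (fun x ↦ q.eval x) D := cfc_congr fun x hx ↦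
    (hq x (Finset.mem_union_left _ (by simpa using hx))).symm
  have h2 : cfc (fun x ↦ q.eval x) D = Polynomial.aeval D q := cfc_polynomial q D
  have h3 : Polynomial.aeval D q =
      diagonal (Polynomial.aeval (fun i ↦ (d i : ℂ)) q) :=
    Polynomial.aeval_algHom_apply (diagonalAlgHom ℝ (n := ι) (α := ℂ)) (fun i ↦ (d i : ℂ)) q
  rw [h1, h2, h3]
  congr 1
  ext1 i
  have h4 := Polynomial.aeval_algHom_apply (Pi.evalAlgHom ℝ (fun _ : ι ↦ ℂ) i)
    (fun i ↦ (d i : ℂ)) q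
  have h5 : Polynomial.aeval ((d i : ℝ) : ℂ) q = ((q.eval (d i) : ℝ) : ℂ) :=
    Polynomial.aeval_algebraMap_apply_eq_algebraMap_eval (A := ℂ) (d i) q
  simp only [Pi.evalAlgHom_apply] at h4
  rw [← h4, h5, hq]
  exact Finset.mem_union_right _ (by simp)

namespace PosDef

variable {A B X Y Z : Matrix ι ι ℂ}

lemma rpow (hA : A.PosDef) (t : ℝ) : (A ^ t).PosDef :=
  isStrictlyPositive_iff_posDef.1 (hA.isStrictlyPositive.rpow A t)

lemma rpow_eq_cfc (hA : A.PosDef) (t : ℝ) : A ^ t = cfc (fun x : ℝ ↦ x ^ t) A :=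
  CFC.rpow_eq_cfc_real hA.nonneg

lemma rpow_rpow (hA : A.PosDef) (x y : ℝ) : (A ^ x) ^ y = A ^ (x * y) := by
  rcases eq_or_ne x 0 with rfl | hx
  · rw [CFC.rpow_zero A hA.nonneg, CFC.one_rpow, zero_mul, CFC.rpow_zero A hA.nonneg]
  · exact CFC.rpow_rpow A x y hx hA.isStrictlyPositive

lemma rpow_add (hA : A.PosDef) (x y : ℝ) : A ^ (x + y) = A ^ x * A ^ y :=
  CFC.rpow_add hA.isUnit

lemma rpow_zero (hA : A.PosDef) : A ^ (0 : ℝ) = 1 := CFC.rpow_zero A hA.nonneg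

lemma rpow_one (hA : A.PosDef) : A ^ (1 : ℝ) = A := CFC.rpow_one A hA.nonneg

lemma rpow_mul_rpow_neg (hA : A.PosDef) (x : ℝ) : A ^ x * A ^ (-x) = 1 :=
  CFC.rpow_mul_rpow_neg x hA.isStrictlyPositive

lemma rpow_neg_mul_rpow (hA : A.PosDef) (x : ℝ) : A ^ (-x) * A ^ x = 1 :=
  CFC.rpow_neg_mul_rpow x hA.isStrictlyPositive

lemma inv_eq_rpow (hA : A.PosDef) : A⁻¹ = A ^ (-1 : ℝ) := by
  apply Matrix.inv_eq_left_inv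
  simpa [hA.rpow_one] using hA.rpow_neg_mul_rpow 1

lemma rpow_neg_le_rpow_neg (hA : A.PosDef) (h : A ≤ B) {t : ℝ} (ht : 0 ≤ t)
    (ht1 : t ≤ 1) : B ^ (-t) ≤ A ^ (-t) := by
  have hB : B.PosDef := isStrictlyPositive_iff_posDef.1 (hA.isStrictlyPositive.of_le h)
  have h1 : A ^ t ≤ B ^ t := CFC.rpow_le_rpow ⟨ht, ht1⟩ h
  have := CStarAlgebra.rpow_neg_one_le_rpow_neg_one h1 (hA.rpow t).isStrictlyPositive
  simpa [hA.rpow_rpow, hB.rpow_rpow] using this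

lemma unit_conj (hX : X.PosDef) (hZ : IsUnit Z) : (Z * X * Zᴴ).PosDef :=
  hX.mul_mul_conjTranspose_same (Matrix.vecMul_injective_iff_isUnit.2 hZ)

lemma conj (hX : X.PosDef) (hY : Y.PosDef) : (Y * X * Y).PosDef := by
  simpa only [hY.isHermitian.eq] using hX.unit_conj hY.isUnit

lemma rpow_conj_rpow (hY : Y.PosDef) (X : Matrix ι ι ℂ) (a : ℝ) :
    Y ^ (-a) * (Y ^ a * X * Y ^ a) * Y ^ (-a) = X := by
  calc _ = (Y ^ (-a) * Y ^ a) * X * (Y ^ a * Y ^ (-a)) := by simp only [mul_assoc]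
    _ = X := by rw [hY.rpow_mul_rpow_neg, hY.rpow_neg_mul_rpow, one_mul, mul_one]

lemma rpow_conj_rpow_neg (hY : Y.PosDef) (X : Matrix ι ι ℂ) (a : ℝ) :
    Y ^ a * (Y ^ (-a) * X * Y ^ (-a)) * Y ^ a = X := by
  simpa using hY.rpow_conj_rpow X (-a)

lemma conj_mono (hY : Y.PosDef) (a : ℝ) (h : A ≤ B) :
    Y ^ a * A * Y ^ a ≤ Y ^ a * B * Y ^ a :=
  conjugate_le_conjugate_of_nonneg h (hY.rpow a).nonneg

lemma rpow_mul_rpow_mul_rpow (hY : Y.PosDef) (a b c : ℝ) :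
    Y ^ a * Y ^ b * Y ^ c = Y ^ (a + b + c) := by
  rw [hY.rpow_add, hY.rpow_add]

/-- With `b = 0`, a bound by `1` becomes `X ≤ Y^(-2a)`, a form to which Löwner–Heinz applies. -/
lemma conj_le_rpow_iff (hY : Y.PosDef) (a b : ℝ) :
    Y ^ a * X * Y ^ a ≤ Y ^ b ↔ X ≤ Y ^ (b - 2 * a) := by
  constructor <;> intro h
  · have := hY.conj_mono (-a) h
    rw [hY.rpow_conj_rpow, hY.rpow_mul_rpow_mul_rpow] at this
    convert this using 2; ring
  · have := hY.conj_mono a h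
    rw [hY.rpow_mul_rpow_mul_rpow] at this
    convert this using 2; ring

lemma unitary_conj_rpow (hX : X.PosDef) (U : unitary (Matrix ι ι ℂ)) (s : ℝ) :
    ((U : Matrix ι ι ℂ) * X * (star U : Matrix ι ι ℂ)) ^ s =
      (U : Matrix ι ι ℂ) * X ^ s * (star U : Matrix ι ι ℂ) := by
  have hU : ((U : Matrix ι ι ℂ) * X * (star U : Matrix ι ι ℂ)).PosDef :=
    hX.unit_conj (Unitary.isUnit_coe)
  rw [hU.rpow_eq_cfc, hX.rpow_eq_cfc, cfc_unitary_conj _ _ hX.isHermitian]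

end PosDef

lemma posDef_mul_conjTranspose {Z : Matrix ι ι ℂ} (hZ : IsUnit Z) : (Z * Zᴴ).PosDef := by
  simpa using PosDef.one.unit_conj hZ

/-- Polar decomposition: `Z = P^{1/2} V` with `P = Z Zᴴ` and `V` unitary, so `Zᴴ Z = V* P V` and
powers pass through `V`. -/
lemma mul_conjTranspose_rpow {Z : Matrix ι ι ℂ} (hZ : IsUnit Z) (s : ℝ) :
    (Z * Zᴴ) ^ s = Z * (Zᴴ * Z) ^ (s - 1) * Zᴴ := by
  have hP := posDef_mul_conjTranspose hZ
  set P := Z * Zᴴ with hPdef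
  set V := P ^ (-(1 / 2) : ℝ) * Z with hV
  have hVs : star V = Zᴴ * P ^ (-(1 / 2) : ℝ) := by
    rw [hV, star_eq_conjTranspose, conjTranspose_mul, (hP.rpow _).isHermitian.eq]
  have hVV : V * star V = 1 := by
    calc V * star V = P ^ (-(1 / 2) : ℝ) * (Z * Zᴴ) * P ^ (-(1 / 2) : ℝ) := by
          rw [hVs, hV]; simp only [mul_assoc]
      _ = P ^ (-(1 / 2) : ℝ) * P ^ (1 : ℝ) * P ^ (-(1 / 2) : ℝ) := by rw [hP.rpow_one]
      _ = 1 := by rw [hP.rpow_mul_rpow_mul_rpow]; norm_num [hP.rpow_zero]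
  have hVV' : star V * V = 1 := mul_eq_one_comm.1 hVV
  let U : unitary (Matrix ι ι ℂ) := ⟨star V, by
    rw [Unitary.mem_iff, star_star]; exact ⟨hVV, hVV'⟩⟩
  have hZV : Z = P ^ (1 / 2 : ℝ) * V := by
    rw [hV, ← mul_assoc, hP.rpow_mul_rpow_neg, one_mul]
  have hZV' : Zᴴ = star V * P ^ (1 / 2 : ℝ) := by
    conv_lhs => rw [hZV]
    rw [conjTranspose_mul, (hP.rpow _).isHermitian.eq, star_eq_conjTranspose]
  have hQ : Zᴴ * Z = (U : Matrix ι ι ℂ) * P * (star U : Matrix ι ι ℂ) := by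
    change _ = star V * P * star (star V)
    rw [star_star]
    calc Zᴴ * Z = star V * (P ^ (1 / 2 : ℝ) * P ^ (1 / 2 : ℝ)) * V := by
          rw [hZV']; conv_lhs => rw [hZV]
          simp only [mul_assoc]
      _ = star V * P * V := by rw [← hP.rpow_add]; norm_num [hP.rpow_one]
  rw [hQ, hP.unitary_conj_rpow]
  change _ = Z * (star V * P ^ (s - 1) * star (star V)) * Zᴴ
  rw [star_star, hZV']
  conv_rhs => rw [hZV]
  calc P ^ s = P ^ (1 / 2 : ℝ) * P ^ (s - 1) * P ^ (1 / 2 : ℝ) := by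
        rw [hP.rpow_mul_rpow_mul_rpow]; congr 1; ring
    _ = P ^ (1 / 2 : ℝ) * (V * star V) * P ^ (s - 1) * (V * star V) * P ^ (1 / 2 : ℝ) := by
        rw [hVV, mul_one, mul_one]
    _ = _ := by simp only [mul_assoc]

lemma norm_mul_conjTranspose_comm (Z : Matrix ι ι ℂ) : ‖Z * Zᴴ‖ = ‖Zᴴ * Z‖ := by
  rw [← star_eq_conjTranspose, CStarRing.norm_self_mul_star, CStarRing.norm_star_mul_self]

/-- `(Y X Y)^s = Y X^{1/2} (X^{1/2} Y² X^{1/2})^{s-1} X^{1/2} Y`. -/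
lemma PosDef.conj_rpow {X Y : Matrix ι ι ℂ} (hX : X.PosDef) (hY : Y.PosDef) (a s : ℝ) :
    (Y ^ a * X * Y ^ a) ^ s = Y ^ a * (X ^ (1 / 2 : ℝ) *
      (X ^ (1 / 2 : ℝ) * Y ^ (2 * a) * X ^ (1 / 2 : ℝ)) ^ (s - 1) * X ^ (1 / 2 : ℝ)) * Y ^ a := by
  have hZ : IsUnit (Y ^ a * X ^ (1 / 2 : ℝ)) := (hY.rpow a).isUnit.mul (hX.rpow _).isUnit
  have h := mul_conjTranspose_rpow hZ s
  have e1 : (Y ^ a * X ^ (1 / 2 : ℝ))ᴴ = X ^ (1 / 2 : ℝ) * Y ^ a := by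
    rw [conjTranspose_mul, (hY.rpow _).isHermitian.eq, (hX.rpow _).isHermitian.eq]
  have e2 : X ^ (1 / 2 : ℝ) * X ^ (1 / 2 : ℝ) = X := by
    rw [← hX.rpow_add]; norm_num [hX.rpow_one]
  have e3 : Y ^ a * Y ^ a = Y ^ (2 * a) := by rw [← hY.rpow_add, two_mul]
  rw [e1] at h
  calc _ = (Y ^ a * X ^ (1 / 2 : ℝ) * (X ^ (1 / 2 : ℝ) * Y ^ a)) ^ s := by
        rw [← mul_assoc, mul_assoc (Y ^ a) (X ^ (1 / 2 : ℝ)), e2]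
    _ = _ := by
        rw [h, ← e3]; simp only [mul_assoc]

end Matrix

/-! ### Order implications of Araki, Furuta and Ando–Hiai type. -/

namespace Matrix

variable {ι : Type*} [Fintype ι] [DecidableEq ι]

namespace PosDef

variable {A B X Y Z : Matrix ι ι ℂ}

lemma conj_rpow_neg_one (hX : X.PosDef) (hY : Y.PosDef) (a : ℝ) :
    (Y ^ a * X * Y ^ a) ^ (-1 : ℝ) = Y ^ (-a) * X ^ (-1 : ℝ) * Y ^ (-a) := by
  have h := hX.conj (hY.rpow a)
  rw [← h.inv_eq_rpow, Matrix.mul_inv_rev, Matrix.mul_inv_rev, hX.inv_eq_rpow,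
    (hY.rpow a).inv_eq_rpow, hY.rpow_rpow, mul_assoc]
  simp

/-- If `Y^q X^q Y^q ≤ 1` for some `q ≥ 1`, then `Y X Y ≤ 1`. -/
lemma conj_le_one_of_rpow_conj_le_one (hX : X.PosDef) (hY : Y.PosDef) {q : ℝ} (hq : 1 ≤ q)
    (h : Y ^ q * X ^ q * Y ^ q ≤ 1) : Y * X * Y ≤ 1 := by
  have hq0 : q ≠ 0 := by positivity
  rw [← hY.rpow_zero, hY.conj_le_rpow_iff] at h
  have h1 := CFC.rpow_le_rpow (p := 1 / q) ⟨by positivity, by rw [div_le_one] <;> linarith⟩ h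
  rw [hX.rpow_rpow, hY.rpow_rpow, mul_one_div_cancel hq0, hX.rpow_one,
    show (0 - 2 * q) * (1 / q) = 0 - 2 * 1 by field_simp; ring] at h1
  rw [← hY.conj_le_rpow_iff, hY.rpow_zero, hY.rpow_one] at h1
  exact h1

/-- By `conj_rpow` the base on the right is `X^{p/2} (X^{p/2} Y^{-u} X^{p/2})^{s-1} X^{p/2}`. Since
`Y^{-u} ≥ X^{-u}` and `s - 1 ∈ [0, 1]`, it dominates `X^{(p-u)s+u}`; taking the root leaves `X ≥ Y`.
-/
lemma le_conj_rpow_aux (hX : X.PosDef) (hY : Y.PosDef) (h : Y ≤ X) {u p s : ℝ} (hu : 0 ≤ u)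
    (hu1 : u ≤ 1) (hp : 1 ≤ p) (hs : 1 ≤ s) (hs2 : s ≤ 2) :
    Y ≤ (Y ^ (u / 2) * (Y ^ (-(u / 2)) * X ^ p * Y ^ (-(u / 2))) ^ s * Y ^ (u / 2)) ^
      (1 / ((p - u) * s + u)) := by
  rw [(hX.rpow p).conj_rpow hY]
  rw [hY.rpow_conj_rpow_neg, hX.rpow_rpow]
  have hYX : X ^ (-u) ≤ Y ^ (2 * -(u / 2)) := by
    convert hY.rpow_neg_le_rpow_neg h hu hu1 using 2; ring
  have h1 := hX.conj_mono (p * (1 / 2)) hYX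
  rw [hX.rpow_mul_rpow_mul_rpow] at h1
  have h2 := CFC.rpow_le_rpow (p := s - 1) ⟨by linarith, by linarith⟩ h1
  rw [hX.rpow_rpow] at h2
  have h3 := hX.conj_mono (p * (1 / 2)) h2
  rw [hX.rpow_mul_rpow_mul_rpow] at h3
  have hβ : 1 ≤ (p - u) * s + u := by nlinarith
  have h4 := CFC.rpow_le_rpow (p := 1 / ((p - u) * s + u))
    ⟨by positivity, by rw [div_le_one] <;> linarith⟩ h3
  rw [hX.rpow_rpow] at h4
  have e1 : (p * (1 / 2) + (p * (1 / 2) + -u + p * (1 / 2)) * (s - 1) + p * (1 / 2)) *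
      (1 / ((p - u) * s + u)) = 1 := by
    rw [mul_one_div, div_eq_one_iff_eq (by positivity)]; ring
  rw [e1, hX.rpow_one] at h4
  exact h.trans h4

/-- A grand Furuta inequality: if `0 < Y ≤ X`, `0 ≤ u ≤ 1`, `1 ≤ p` and `1 ≤ s`, then
`Y ≤ (Y^{u/2} (Y^{-u/2} X^p Y^{-u/2})^s Y^{u/2})^{1/((p-u)s+u)}`. -/
lemma le_conj_rpow (hX : X.PosDef) (hY : Y.PosDef) (h : Y ≤ X) {u p s : ℝ} (hu : 0 ≤ u)
    (hu1 : u ≤ 1) (hp : 1 ≤ p) (hs : 1 ≤ s) :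
    Y ≤ (Y ^ (u / 2) * (Y ^ (-(u / 2)) * X ^ p * Y ^ (-(u / 2))) ^ s * Y ^ (u / 2)) ^
      (1 / ((p - u) * s + u)) := by
  obtain ⟨n, hn⟩ := pow_unbounded_of_one_lt s (one_lt_two (α := ℝ))
  induction n generalizing X p s with
  | zero => exact le_conj_rpow_aux hX hY h hu hu1 hp hs (by norm_num at hn; linarith)
  | succ n ih =>
    rcases le_total s 2 with hs2 | hs2
    · exact le_conj_rpow_aux hX hY h hu hu1 hp hs hs2
    -- The case `s = 2` gives `Y ≤ C^{1/β}` with `β = 2(p-u)+u`. Apply induction to `C^{1/β}`, `β`,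
    -- `s/2`: its `β`-th power is `C`, and `Y^{-u/2} C Y^{-u/2} = Z²`, so the power `s/2` restores
    -- `Z^s`.
    have h2 := le_conj_rpow_aux hX hY h hu hu1 hp one_le_two le_rfl
    have hZ : (Y ^ (-(u / 2)) * X ^ p * Y ^ (-(u / 2))).PosDef := (hX.rpow p).conj (hY.rpow _)
    set Z := Y ^ (-(u / 2)) * X ^ p * Y ^ (-(u / 2)) with hZdef
    have hC : (Y ^ (u / 2) * Z ^ (2 : ℝ) * Y ^ (u / 2)).PosDef := (hZ.rpow _).conj (hY.rpow _)
    have hβ : 1 ≤ (p - u) * 2 + u := by nlinarith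
    have h3 := ih (hC.rpow _) h2 hβ (s := s / 2) (by linarith) (by rw [pow_succ] at hn; linarith)
    rw [hC.rpow_rpow, one_div_mul_cancel (by positivity), hC.rpow_one, hY.rpow_conj_rpow,
      hZ.rpow_rpow] at h3
    convert h3 using 3
    · congr 2; ring
    · ring

lemma geomMean (hA : A.PosDef) (hB : B.PosDef) (r : ℝ) : (geomMean r A B).PosDef :=
  ((hB.conj (hA.rpow _)).rpow _).conj (hA.rpow _)

lemma geomMean_inv_left (hA : A.PosDef) (r : ℝ) (B : Matrix ι ι ℂ) :
    Matrix.geomMean r A⁻¹ B =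
      A ^ (-(1 / 2) : ℝ) * (A ^ (1 / 2 : ℝ) * B * A ^ (1 / 2 : ℝ)) ^ r * A ^ (-(1 / 2) : ℝ) := by
  rw [Matrix.geomMean, hA.inv_eq_rpow, hA.rpow_rpow, hA.rpow_rpow]
  norm_num

lemma spectralGeomMean (hA : A.PosDef) (hB : B.PosDef) (k t : ℝ) :
    (spectralGeomMean k t A B).PosDef :=
  (hA.rpow _).conj ((hA.inv.geomMean hB k).rpow _)

/-- With `G = A⁻¹ #_k B` the hypothesis reads `A^α ≤ G^{-2t}`. The Furuta parameters are chosen so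
that `G^{-2t}` is raised to `G⁻¹`, conjugation by `A^{-1/2}` gives `(A^{1/2} B A^{1/2})^{-k}`, and
the power `1/k` followed by conjugation by `A^{1/2}` leaves `B⁻¹`. -/
lemma conj_le_one_of_spectralGeomMean_le_one (hA : A.PosDef) (hB : B.PosDef) {k t : ℝ}
    (hk : 0 < k) (hk2 : k ≤ 1 / 2) (ht : 0 < t) (ht2 : t ≤ 1 / 2)
    (h : Matrix.spectralGeomMean k t A B ≤ 1) :
    A ^ (1 / 2 : ℝ) * B ^ (2 * k * t / (1 - 2 * k * t)) * A ^ (1 / 2 : ℝ) ≤ 1 := by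
  have hG := hA.inv.geomMean hB k
  rw [Matrix.spectralGeomMean] at h
  set α := 1 + 2 * t - 4 * k * t with hα
  have hα1 : 1 ≤ α := by nlinarith
  have hα0 : α ≠ 0 := by positivity
  rw [← hG.rpow_zero, hG.conj_le_rpow_iff] at h
  have hW := hB.conj (hA.rpow (1 / 2))
  have h1 := le_conj_rpow (hG.rpow _) (hA.rpow α) h (u := 1 / α) (p := 1 / (2 * t)) (s := 1 / k)
    (by positivity) (by rw [div_le_one] <;> linarith) (by rw [le_div_iff₀] <;> linarith)
    (by rw [le_div_iff₀] <;> linarith)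
  have e1 : (0 - 2 * t) * (1 / (2 * t)) = -1 := by field_simp; ring
  have e2 : α * (1 / α / 2) = 1 / 2 := by field_simp
  have e3 : α * -(1 / α / 2) = -(1 / 2) := by field_simp
  rw [hG.rpow_rpow, e1, hA.rpow_rpow, hA.rpow_rpow, e2, e3, hA.geomMean_inv_left,
    conj_rpow_neg_one (hW.rpow k) hA, neg_neg, hA.rpow_conj_rpow, hW.rpow_rpow, hW.rpow_rpow,
    show k * -1 * (1 / k) = -1 by field_simp, conj_rpow_neg_one hB hA] at h1
  rw [hA.rpow_conj_rpow_neg, hB.rpow_rpow] at h1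
  have h2 := CFC.rpow_le_rpow (p := 1 / α) ⟨by positivity, by rw [div_le_one] <;> linarith⟩ h1
  have hkt : 0 < 1 - 2 * k * t := by nlinarith
  have hD : (1 / (2 * t) - 1 / α) * (1 / k) + 1 / α = (1 - 2 * k * t) / (2 * k * t * α) := by
    field_simp; rw [hα]; ring
  rw [hA.rpow_rpow, hB.rpow_rpow, mul_one_div_cancel hα0, hA.rpow_one, hD,
    show -1 * (1 / ((1 - 2 * k * t) / (2 * k * t * α))) * (1 / α) =
      -(2 * k * t / (1 - 2 * k * t)) by field_simp] at h2
  have h3 := hA.rpow_neg_le_rpow_neg h2 zero_le_one le_rfl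
  rw [hB.rpow_rpow, neg_mul_neg, mul_one] at h3
  rw [← hA.rpow_zero, hA.conj_le_rpow_iff]
  convert h3 using 2; norm_num

/-- The hypothesis bounds `B` by a power of `A`. The powers `k` and `-2t` preserve, respectively
reverse, the order, giving first `G ≤ A^{-α/(2t)}` and then `A^α ≤ G^{-2t}`, where `G = A⁻¹ #_k B`
and `α = 1 + 2t - 4kt`. -/
lemma spectralGeomMean_le_one (hA : A.PosDef) (hB : B.PosDef) {k t : ℝ}
    (hk : 0 < k) (hk2 : k ≤ 1 / 2) (ht : 0 < t) (ht2 : t ≤ 1 / 2)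
    (h : A ^ ((1 - 2 * k * t) / (4 * k * t)) * B * A ^ ((1 - 2 * k * t) / (4 * k * t)) ≤ 1) :
    Matrix.spectralGeomMean k t A B ≤ 1 := by
  have hG := hA.inv.geomMean hB k
  rw [← hA.rpow_zero, hA.conj_le_rpow_iff] at h
  have h1 := hA.conj_mono (1 / 2) h
  rw [hA.rpow_mul_rpow_mul_rpow] at h1
  have h2 := CFC.rpow_le_rpow (p := k) ⟨by positivity, by linarith⟩ h1
  rw [hA.rpow_rpow] at h2
  have h3 := hA.conj_mono (-(1 / 2)) h2
  rw [hA.rpow_mul_rpow_mul_rpow, ← hA.geomMean_inv_left] at h3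
  have h4 := hG.rpow_neg_le_rpow_neg h3 (t := 2 * t) (by positivity) (by linarith)
  rw [hA.rpow_rpow] at h4
  rw [Matrix.spectralGeomMean, ← hG.rpow_zero, hG.conj_le_rpow_iff]
  convert h4 using 2
  · field_simp; ring
  · ring

lemma geomMean_comm (hA : A.PosDef) (hB : B.PosDef) (r : ℝ) :
    Matrix.geomMean r A B = Matrix.geomMean (1 - r) B A := by
  rw [Matrix.geomMean, hB.conj_rpow hA]
  rw [hA.rpow_conj_rpow_neg, Matrix.geomMean]
  have h := conj_rpow_neg_one hA hB (-(1 / 2))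
  have hV := hA.conj (hB.rpow (-(1 / 2)))
  rw [neg_neg] at h
  rw [show (2 * -(1 / 2) : ℝ) = -1 by norm_num, ← h, hV.rpow_rpow]
  congr 3; ring

lemma geomMean_mono_right (hA : A.PosDef) {r : ℝ} (hr : 0 ≤ r) (hr1 : r ≤ 1) (h : X ≤ Y) :
    Matrix.geomMean r A X ≤ Matrix.geomMean r A Y :=
  hA.conj_mono _ (CFC.rpow_le_rpow ⟨hr, hr1⟩ (hA.conj_mono _ h))

lemma geomMean_mono_left (hA : A.PosDef) (hB : B.PosDef) (hX : X.PosDef) {r : ℝ} (hr : 0 ≤ r)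
    (hr1 : r ≤ 1) (h : A ≤ B) : Matrix.geomMean r A X ≤ Matrix.geomMean r B X := by
  rw [hA.geomMean_comm hX, hB.geomMean_comm hX]
  exact hX.geomMean_mono_right (by linarith) (by linarith) h

lemma geomMean_rpow_rpow (hA : A.PosDef) (a b r : ℝ) :
    Matrix.geomMean r (A ^ a) (A ^ b) = A ^ ((1 - r) * a + r * b) := by
  simp only [Matrix.geomMean, hA.rpow_rpow, hA.rpow_mul_rpow_mul_rpow]
  congr 1; ring

/-- If `A #_r B ≤ 1`, then `A² #_r B² ≤ 1`. -/
lemma geomMean_sq_le_one (hA : A.PosDef) (hB : B.PosDef) {r : ℝ} (hr : 0 ≤ r) (hr1 : r ≤ 1)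
    (h : Matrix.geomMean r A B ≤ 1) :
    Matrix.geomMean r (A ^ (2 : ℝ)) (B ^ (2 : ℝ)) ≤ 1 := by
  have hC := hB.conj (hA.rpow (-(1 / 2)))
  set C := A ^ (-(1 / 2) : ℝ) * B * A ^ (-(1 / 2) : ℝ) with hCdef
  have hBC : B = A ^ (1 / 2 : ℝ) * C * A ^ (1 / 2 : ℝ) :=
    (hA.rpow_conj_rpow_neg B _).symm
  have hG : Matrix.geomMean r A B = A ^ (1 / 2 : ℝ) * C ^ r * A ^ (1 / 2 : ℝ) := rfl
  have hAC : A ≤ C ^ (-r) := by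
    have h' := h
    rw [hG, ← hA.rpow_zero, hA.conj_le_rpow_iff] at h'
    have := (hC.rpow r).rpow_neg_le_rpow_neg h' zero_le_one le_rfl
    rw [hA.rpow_rpow, hC.rpow_rpow] at this
    norm_num [hA.rpow_one] at this
    exact this
  have hB2 : A ^ (-1 : ℝ) * B ^ (2 : ℝ) * A ^ (-1 : ℝ) =
      A ^ (-(1 / 2) : ℝ) * (C * A * C) * A ^ (-(1 / 2) : ℝ) := by
    have e1 : A ^ (-1 : ℝ) * A ^ (1 / 2 : ℝ) = A ^ (-(1 / 2) : ℝ) := by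
      rw [← hA.rpow_add]; norm_num
    have e2 : A ^ (1 / 2 : ℝ) * A ^ (-1 : ℝ) = A ^ (-(1 / 2) : ℝ) := by
      rw [← hA.rpow_add]; norm_num
    have e3 : A ^ (1 / 2 : ℝ) * A ^ (1 / 2 : ℝ) = A := by
      rw [← hA.rpow_add]; norm_num [hA.rpow_one]
    have e4 : B ^ (2 : ℝ) = B * B := by
      rw [show (2 : ℝ) = 1 + 1 by norm_num, hB.rpow_add, hB.rpow_one]
    calc A ^ (-1 : ℝ) * B ^ (2 : ℝ) * A ^ (-1 : ℝ)
        = (A ^ (-1 : ℝ) * A ^ (1 / 2 : ℝ)) * (C * (A ^ (1 / 2 : ℝ) * A ^ (1 / 2 : ℝ)) * C) *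
          (A ^ (1 / 2 : ℝ) * A ^ (-1 : ℝ)) := by
          rw [e4]; conv_lhs => rw [hBC]
          simp only [mul_assoc]
      _ = _ := by rw [e1, e2, e3]
  have hCAC : C * A * C ≤ C ^ (2 - r) := by
    have := hC.conj_mono 1 hAC
    rw [hC.rpow_mul_rpow_mul_rpow, hC.rpow_one] at this
    convert this using 2; ring
  -- Joint monotonicity replaces `A` by `C^{-r}` and `CAC` by `C^{2-r}`. Their mean is exactly
  -- `C^r`, which returns `A #_r B`.
  calc Matrix.geomMean r (A ^ (2 : ℝ)) (B ^ (2 : ℝ))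
      = A ^ (1 / 2 : ℝ) * Matrix.geomMean r A (C * A * C) * A ^ (1 / 2 : ℝ) := by
        have e3 : A ^ (1 / 2 : ℝ) * A ^ (1 / 2 : ℝ) = A ^ (1 : ℝ) := by
          rw [← hA.rpow_add]; norm_num
        simp only [Matrix.geomMean, hA.rpow_rpow]
        norm_num only
        rw [hB2, ← e3]
        norm_num only [mul_assoc]
    _ ≤ A ^ (1 / 2 : ℝ) * Matrix.geomMean r (C ^ (-r)) (C ^ (2 - r)) * A ^ (1 / 2 : ℝ) :=
        hA.conj_mono _ ((hA.geomMean_mono_right hr hr1 hCAC).trans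
          (hA.geomMean_mono_left (hC.rpow _) (hC.rpow _) hr hr1 hAC))
    _ = Matrix.geomMean r A B := by
        rw [hC.geomMean_rpow_rpow, hG]; congr 3; ring
    _ ≤ 1 := h

end PosDef
end Matrix

/-! ### From order implications to norm inequalities. -/

namespace Matrix

variable {ι : Type*} [Fintype ι] [DecidableEq ι] {A B X Y : Matrix ι ι ℂ}

namespace PosDef

lemma smul_rpow (hA : A.PosDef) {c : ℝ} (hc : 0 < c) (t : ℝ) : (c • A) ^ t = c ^ t • A ^ t := by
  have hcA : (c • A).PosDef := hA.smul hc
  rw [hcA.rpow_eq_cfc, hA.rpow_eq_cfc]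
  refine (cfc_comp_smul c (fun x : ℝ ↦ x ^ t) A
    ((A.finite_real_spectrum.image _).continuousOn _) hA.isHermitian).symm.trans
    (Eq.trans ?_ (cfc_smul (c ^ t) (fun x : ℝ ↦ x ^ t) A
      (A.finite_real_spectrum.continuousOn _)))
  refine cfc_congr fun x hx ↦ ?_
  have hx0 : 0 ≤ x := spectrum_nonneg_of_nonneg hA.nonneg hx
  simp [Real.mul_rpow hc.le hx0]

lemma norm_rpow (hA : A.PosDef) {t : ℝ} (ht : 0 < t) : ‖A ^ t‖ = ‖A‖ ^ t :=
  CFC.norm_rpow A ht hA.nonneg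

lemma geomMean_smul (hA : A.PosDef) (hB : B.PosDef) {c : ℝ} (hc : 0 < c) (r : ℝ) :
    Matrix.geomMean r A (c • B) = c ^ r • Matrix.geomMean r A B := by
  simp only [Matrix.geomMean, mul_smul_comm, smul_mul_assoc,
    (hB.conj (hA.rpow _)).smul_rpow hc]

lemma spectralGeomMean_smul (hA : A.PosDef) (hB : B.PosDef) {c : ℝ} (hc : 0 < c) (k t : ℝ) :
    Matrix.spectralGeomMean k t A (c • B) =
      c ^ (2 * k * t) • Matrix.spectralGeomMean k t A B := by
  have hck := Real.rpow_pos_of_pos hc k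
  rw [Matrix.spectralGeomMean, hA.inv.geomMean_smul hB hc, (hA.inv.geomMean hB k).smul_rpow hck,
    ← Real.rpow_mul hc.le]
  simp only [mul_smul_comm, smul_mul_assoc, smul_smul]
  rw [← Real.rpow_add hc, Matrix.spectralGeomMean]
  congr 2; ring

end PosDef

/-- An implication `ψ ≤ 1 → φ ≤ 1` between homogeneous functions yields a norm inequality. -/
lemma norm_le_of_homogeneous {φ ψ : Matrix ι ι ℂ → Matrix ι ι ℂ} {u v : ℝ} (hv : 0 < v)
    (hφ : ∀ X, X.PosDef → (φ X).PosDef) (hψ : ∀ X, X.PosDef → (ψ X).PosDef)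
    (hφs : ∀ X, X.PosDef → ∀ c : ℝ, 0 < c → φ (c • X) = c ^ u • φ X)
    (hψs : ∀ X, X.PosDef → ∀ c : ℝ, 0 < c → ψ (c • X) = c ^ v • ψ X)
    (h : ∀ X, X.PosDef → ψ X ≤ 1 → φ X ≤ 1) (hB : B.PosDef) :
    ‖φ B‖ ≤ ‖ψ B‖ ^ (u / v) := by
  cases isEmpty_or_nonempty ι
  · rw [Subsingleton.elim (φ B) 0, norm_zero]; positivity
  set c := ‖ψ B‖ with hc
  have hc0 : 0 < c := norm_pos_iff.2 (hψ B hB).isUnit.ne_zero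
  -- Scaling `B` by this factor makes the norm of `ψ` equal to `1`.
  have hd : 0 < c ^ (-(1 / v)) := Real.rpow_pos_of_pos hc0 _
  have hB' : (c ^ (-(1 / v)) • B).PosDef := hB.smul hd
  have h1 := h _ hB' <| by
    rw [← CStarAlgebra.norm_le_one_iff_of_nonneg _ (hψ _ hB').nonneg, hψs B hB _ hd,
      norm_smul, ← hc, ← Real.rpow_mul hc0.le, show -(1 / v) * v = -1 by field_simp,
      Real.rpow_neg_one, norm_inv, Real.norm_of_nonneg hc0.le, inv_mul_cancel₀ hc0.ne']
  rw [← CStarAlgebra.norm_le_one_iff_of_nonneg _ (hφ _ hB').nonneg, hφs B hB _ hd, norm_smul,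
    ← Real.rpow_mul hc0.le, show -(1 / v) * u = -(u / v) by ring,
    Real.norm_of_nonneg (by positivity), Real.rpow_neg hc0.le,
    inv_mul_le_iff₀ (by positivity), mul_one] at h1
  exact h1

namespace PosDef

lemma norm_conj_le (hX : X.PosDef) (hY : Y.PosDef) {q : ℝ} (hq : 1 ≤ q) :
    ‖Y * X * Y‖ ≤ ‖Y ^ q * X ^ q * Y ^ q‖ ^ (1 / q) := by
  refine norm_le_of_homogeneous (φ := fun X ↦ Y * X * Y) (ψ := fun X ↦ Y ^ q * X ^ q * Y ^ q)
    (by linarith) (fun X hX ↦ hX.conj hY) (fun X hX ↦ (hX.rpow q).conj (hY.rpow q))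
    (fun X hX c hc ↦ ?_) (fun X hX c hc ↦ ?_)
    (fun X hX h ↦ hX.conj_le_one_of_rpow_conj_le_one hY hq h) hX
  · simp
  · simp only [hX.smul_rpow hc, mul_smul_comm, smul_mul_assoc]

lemma norm_geomMean_sq_le (hA : A.PosDef) (hB : B.PosDef) {r : ℝ} (hr : 0 < r) (hr1 : r ≤ 1) :
    ‖Matrix.geomMean r (A ^ (2 : ℝ)) (B ^ (2 : ℝ))‖ ≤ ‖Matrix.geomMean r A B‖ ^ (2 : ℝ) := by
  have := norm_le_of_homogeneous (φ := fun B ↦ Matrix.geomMean r (A ^ (2 : ℝ)) (B ^ (2 : ℝ)))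
    (ψ := fun B ↦ Matrix.geomMean r A B) (u := 2 * r) hr
    (fun X hX ↦ (hA.rpow _).geomMean (hX.rpow _) r) (fun X hX ↦ hA.geomMean hX r)
    (fun X hX c hc ↦ ?_) (fun X hX c hc ↦ hA.geomMean_smul hX hc r)
    (fun X hX h ↦ hA.geomMean_sq_le_one hX hr.le hr1 h) hB
  · rwa [mul_div_cancel_right₀ _ hr.ne'] at this
  · rw [hX.smul_rpow hc, (hA.rpow _).geomMean_smul (hX.rpow _) (by positivity),
      ← Real.rpow_mul hc.le]

variable {k t : ℝ}

lemma norm_conj_le_spectralGeomMean (hA : A.PosDef) (hB : B.PosDef)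
    (hk : 0 < k) (hk2 : k ≤ 1 / 2) (ht : 0 < t) (ht2 : t ≤ 1 / 2) :
    ‖A ^ (1 / 2 : ℝ) * B ^ (2 * k * t / (1 - 2 * k * t)) * A ^ (1 / 2 : ℝ)‖ ≤
      ‖Matrix.spectralGeomMean k t A B‖ ^ (1 / (1 - 2 * k * t)) := by
  have := norm_le_of_homogeneous
    (φ := fun B ↦ A ^ (1 / 2 : ℝ) * B ^ (2 * k * t / (1 - 2 * k * t)) * A ^ (1 / 2 : ℝ))
    (ψ := fun B ↦ Matrix.spectralGeomMean k t A B)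
    (u := 2 * k * t / (1 - 2 * k * t)) (v := 2 * k * t) (by positivity)
    (fun X hX ↦ (hX.rpow _).conj (hA.rpow _)) (fun X hX ↦ hA.spectralGeomMean hX k t)
    (fun X hX c hc ↦ by simp only [hX.smul_rpow hc, mul_smul_comm, smul_mul_assoc])
    (fun X hX c hc ↦ hA.spectralGeomMean_smul hX hc k t)
    (fun X hX h ↦ hA.conj_le_one_of_spectralGeomMean_le_one hX hk hk2 ht ht2 h) hB
  convert this using 2
  have : 0 < 1 - 2 * k * t := by nlinarith
  field_simp

lemma norm_spectralGeomMean_le (hA : A.PosDef) (hB : B.PosDef)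
    (hk : 0 < k) (hk2 : k ≤ 1 / 2) (ht : 0 < t) (ht2 : t ≤ 1 / 2) :
    ‖Matrix.spectralGeomMean k t A B‖ ≤
      ‖A ^ ((1 - 2 * k * t) / (4 * k * t)) * B * A ^ ((1 - 2 * k * t) / (4 * k * t))‖ ^
        (2 * k * t) := by
  have := norm_le_of_homogeneous (φ := fun B ↦ Matrix.spectralGeomMean k t A B)
    (ψ := fun B ↦
      A ^ ((1 - 2 * k * t) / (4 * k * t)) * B * A ^ ((1 - 2 * k * t) / (4 * k * t)))
    one_pos (fun X hX ↦ hA.spectralGeomMean hX k t) (fun X hX ↦ hX.conj (hA.rpow _))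
    (fun X hX c hc ↦ hA.spectralGeomMean_smul hX hc k t)
    (fun X hX c hc ↦ by simp)
    (fun X hX h ↦ hA.spectralGeomMean_le_one hX hk hk2 ht ht2 h) hB
  rwa [div_one] at this

end PosDef
end Matrix

/-! ### Compound matrices and products of eigenvalues. -/

namespace Matrix

variable {n : ℕ}

/-- The `j`-th compound matrix, whose entries are the minors of size `j`. -/
noncomputable def compound (j : ℕ) (A : Matrix (Fin n) (Fin n) ℂ) :
    Matrix (Set.powersetCard (Fin n) j) (Set.powersetCard (Fin n) j) ℂ :=
  of fun s t ↦ (A.submatrix (Set.powersetCard.ofFinEmbEquiv.symm s)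
    (Set.powersetCard.ofFinEmbEquiv.symm t)).det

/-- This makes multiplicativity (Cauchy–Binet) the functoriality of the exterior power. -/
lemma compound_eq_toMatrix (j : ℕ) (A : Matrix (Fin n) (Fin n) ℂ) :
    compound j A = LinearMap.toMatrix ((Pi.basisFun ℂ (Fin n)).exteriorPower j)
      ((Pi.basisFun ℂ (Fin n)).exteriorPower j) (exteriorPower.map j (toLin' A)) := by
  ext s t
  rw [LinearMap.toMatrix_apply, exteriorPower.basis_repr_apply, exteriorPower.basis_apply,
    exteriorPower.ιMulti_family, exteriorPower.map_apply_ιMulti,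
    exteriorPower.ιMultiDual_apply_ιMulti, compound, of_apply, ← det_transpose]
  congr 1
  ext a b
  simp

lemma compound_mul (j : ℕ) (A B : Matrix (Fin n) (Fin n) ℂ) :
    compound j (A * B) = compound j A * compound j B := by
  simp only [compound_eq_toMatrix]
  rw [← LinearMap.toMatrix_mul, toLin'_mul, Module.End.mul_eq_comp, exteriorPower.map_comp]

lemma compound_one (j : ℕ) : compound j (1 : Matrix (Fin n) (Fin n) ℂ) = 1 := by
  rw [compound_eq_toMatrix, toLin'_one, exteriorPower.map_id, LinearMap.toMatrix_id]

lemma compound_conjTranspose (j : ℕ) (A : Matrix (Fin n) (Fin n) ℂ) :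
    compound j Aᴴ = (compound j A)ᴴ := by
  ext s t
  simp [compound, conjTranspose_apply, ← det_conjTranspose]

lemma compound_diagonal (j : ℕ) (d : Fin n → ℂ) :
    compound j (diagonal d) =
      diagonal fun s : Set.powersetCard (Fin n) j ↦ ∏ i ∈ (s : Finset (Fin n)), d i := by
  ext s t
  rw [compound, of_apply, diagonal_apply]
  split_ifs with hst
  · subst hst
    rw [submatrix_diagonal _ _ (Set.powersetCard.ofFinEmbEquiv.symm s).injective, det_diagonal]
    simp only [Function.comp_apply]
    rw [← Finset.prod_image (f := d) (g := Set.powersetCard.ofFinEmbEquiv.symm s)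
      (fun x _ y _ h ↦ (Set.powersetCard.ofFinEmbEquiv.symm s).injective h)]
    congr 1
    ext i
    simp only [Finset.mem_image, Finset.mem_univ, true_and]
    exact Set.powersetCard.mem_range_ofFinEmbEquiv_symm_iff_mem s i
  · obtain ⟨i, his, hit⟩ := (Set.powersetCard.exists_mem_notMem_iff_ne s t).mp hst
    obtain ⟨a, rfl⟩ := (Set.powersetCard.mem_range_ofFinEmbEquiv_symm_iff_mem s i).mpr his
    refine det_eq_zero_of_row_eq_zero a fun b ↦ ?_
    rw [submatrix_apply, diagonal_apply_ne]
    intro h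
    exact hit ((Set.powersetCard.mem_range_ofFinEmbEquiv_symm_iff_mem t _).mp ⟨b, h.symm⟩)

lemma continuous_compound (j : ℕ) :
    Continuous (compound j : Matrix (Fin n) (Fin n) ℂ → _) :=
  continuous_matrix fun _ _ ↦ (continuous_id.matrix_submatrix _ _).matrix_det

lemma compound_mem_unitary (j : ℕ) (U : unitary (Matrix (Fin n) (Fin n) ℂ)) :
    compound j (U : Matrix (Fin n) (Fin n) ℂ) ∈
      unitary (Matrix (Set.powersetCard (Fin n) j) (Set.powersetCard (Fin n) j) ℂ) := by
  have h1 := Unitary.coe_star_mul_self U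
  have h2 : (U : Matrix (Fin n) (Fin n) ℂ) * star (U : Matrix (Fin n) (Fin n) ℂ) = 1 :=
    Unitary.coe_mul_star_self U
  rw [Unitary.mem_iff, star_eq_conjTranspose, ← compound_conjTranspose, ← compound_mul,
    ← compound_mul, ← star_eq_conjTranspose, h1, h2, compound_one]
  exact ⟨rfl, rfl⟩

/-- A compound of the unitary factor of a spectral decomposition. -/
noncomputable def IsHermitian.compoundUnitary {A : Matrix (Fin n) (Fin n) ℂ}
    (hA : A.IsHermitian) (j : ℕ) :
    unitary (Matrix (Set.powersetCard (Fin n) j) (Set.powersetCard (Fin n) j) ℂ) :=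
  ⟨_, compound_mem_unitary j hA.eigenvectorUnitary⟩

/-- The unitary does not depend on `f`, so the compounds of `A` and of `A^t` are diagonalized
together. -/
lemma IsHermitian.compound_cfc {A : Matrix (Fin n) (Fin n) ℂ} (hA : A.IsHermitian) (j : ℕ)
    (f : ℝ → ℝ) :
    compound j (cfc f A) = (hA.compoundUnitary j : Matrix _ _ ℂ) *
      diagonal (fun s : Set.powersetCard (Fin n) j ↦
        ((∏ i ∈ (s : Finset (Fin n)), f (hA.eigenvalues i) : ℝ) : ℂ)) *
      (star (hA.compoundUnitary j) : Matrix _ _ ℂ) := by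
  rw [hA.cfc_eq, IsHermitian.cfc, Unitary.conjStarAlgAut_apply, compound_mul, compound_mul,
    compound_diagonal]
  simp only [Function.comp_apply, Complex.ofReal_prod]
  rw [← Unitary.coe_star, Unitary.coe_star, star_eq_conjTranspose, compound_conjTranspose]
  rfl

lemma IsHermitian.compound_eq {A : Matrix (Fin n) (Fin n) ℂ} (hA : A.IsHermitian) (j : ℕ) :
    compound j A = (hA.compoundUnitary j : Matrix _ _ ℂ) *
      diagonal (fun s : Set.powersetCard (Fin n) j ↦
        ((∏ i ∈ (s : Finset (Fin n)), hA.eigenvalues i : ℝ) : ℂ)) *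
      (star (hA.compoundUnitary j) : Matrix _ _ ℂ) := by
  conv_lhs => rw [← cfc_id ℝ A hA]
  exact hA.compound_cfc j id

lemma PosDef.compound {A : Matrix (Fin n) (Fin n) ℂ} (hA : A.PosDef) (j : ℕ) :
    (compound j A).PosDef := by
  rw [hA.isHermitian.compound_eq]
  refine PosDef.unit_conj (PosDef.diagonal fun s ↦ ?_) Unitary.isUnit_coe
  exact_mod_cast Finset.prod_pos fun i _ ↦ hA.eigenvalues_pos i

lemma PosDef.compound_rpow {A : Matrix (Fin n) (Fin n) ℂ} (hA : A.PosDef) (j : ℕ) (t : ℝ) :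
    Matrix.compound j (A ^ t) = Matrix.compound j A ^ t := by
  rw [(hA.compound j).rpow_eq_cfc, hA.rpow_eq_cfc, hA.isHermitian.compound_cfc,
    hA.isHermitian.compound_eq, cfc_unitary_conj, cfc_diagonal]
  · congr 3
    ext1 s
    rw [Real.finsetProd_rpow _ _ fun i _ ↦ (hA.eigenvalues_pos i).le]
  · exact isHermitian_diagonal_of_self_adjoint _ (by ext; simp)

lemma PosDef.compound_inv {A : Matrix (Fin n) (Fin n) ℂ} (hA : A.PosDef) (j : ℕ) :
    Matrix.compound j A⁻¹ = (Matrix.compound j A)⁻¹ := by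
  rw [hA.inv_eq_rpow, hA.compound_rpow, (hA.compound j).inv_eq_rpow]

lemma PosDef.compound_geomMean {A B : Matrix (Fin n) (Fin n) ℂ} (hA : A.PosDef) (hB : B.PosDef)
    (j : ℕ) (r : ℝ) :
    Matrix.compound j (Matrix.geomMean r A B) =
      Matrix.geomMean r (Matrix.compound j A) (Matrix.compound j B) := by
  simp only [Matrix.geomMean, compound_mul, hA.compound_rpow,
    (hB.conj (hA.rpow (-(1 / 2)))).compound_rpow]

lemma PosDef.compound_spectralGeomMean {A B : Matrix (Fin n) (Fin n) ℂ} (hA : A.PosDef)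
    (hB : B.PosDef) (j : ℕ) (k t : ℝ) :
    Matrix.compound j (Matrix.spectralGeomMean k t A B) =
      Matrix.spectralGeomMean k t (Matrix.compound j A) (Matrix.compound j B) := by
  simp only [Matrix.spectralGeomMean, compound_mul, hA.compound_rpow,
    (hA.inv.geomMean hB k).compound_rpow, hA.inv.compound_geomMean hB, hA.compound_inv]

/-- The `a`-th element of `s` in increasing order, counted from `0`, is at least `a`. -/
lemma prod_le_prod_of_antitone {N j : ℕ} {f : Fin N → ℝ} (hf : Antitone f) (h0 : ∀ i, 0 ≤ f i)
    {s : Finset (Fin N)} (hs : s.card = j) : ∏ i ∈ s, f i ≤ ∏ i with i.val < j, f i := by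
  have hjN : j ≤ N := hs ▸ (Finset.card_le_univ s).trans_eq (Fintype.card_fin N)
  have e1 : ∏ i ∈ s, f i = ∏ a : Fin j, f (s.orderEmbOfFin hs a) := by
    rw [← Finset.prod_image (fun x _ y _ h ↦ (s.orderEmbOfFin hs).injective h)]
    rw [Finset.image_orderEmbOfFin_univ]
  have e2 : ∏ i with i.val < j, f i = ∏ a : Fin j, f (Fin.castLE hjN a) := by
    rw [← Finset.prod_image (fun x _ y _ h ↦ Fin.castLE_injective hjN h)]
    congr 1
    ext i
    simp only [Finset.mem_filter, Finset.mem_univ, true_and, Finset.mem_image]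
    exact ⟨fun h ↦ ⟨⟨i, h⟩, rfl⟩, by rintro ⟨a, rfl⟩; exact a.isLt⟩
  rw [e1, e2]
  refine Finset.prod_le_prod (fun _ _ ↦ h0 _) fun a _ ↦ hf ?_
  rw [Fin.le_def, Fin.val_castLE]
  obtain ⟨a, ha⟩ := a
  induction a with
  | zero => exact Nat.zero_le _
  | succ a ih =>
    exact (Nat.succ_le_succ (ih (by omega) (Finset.mem_univ _))).trans
      (Fin.lt_def.1 ((s.orderEmbOfFin hs).strictMono (Fin.mk_lt_mk.2 a.lt_succ_self)))

/-- Unitary invariance leaves the norm of a diagonal matrix, the maximum of eigenvalue products over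
`j`-subsets; the first `j` eigenvalues attain it. -/
lemma PosSemidef.norm_compound {A : Matrix (Fin n) (Fin n) ℂ} (hA : A.PosSemidef) {j : ℕ}
    (hj : j ≤ n) :
    ‖Matrix.compound j A‖ = ∏ i with i.val < j, hA.isHermitian.eigenvalues₀ i := by
  -- The equivalence by which `eigenvalues` reindexes `eigenvalues₀`.
  set e : Fin (Fintype.card (Fin n)) ≃ Fin n := Fintype.equivOfCardEq (Fintype.card_fin _) with he
  have h0 : ∀ i, 0 ≤ hA.isHermitian.eigenvalues₀ i := fun i ↦ by
    have := hA.eigenvalues_nonneg (e i)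
    simpa [IsHermitian.eigenvalues, ← he] using this
  rw [hA.isHermitian.compound_eq, ← Unitary.coe_star, CStarRing.norm_mul_coe_unitary,
    CStarRing.norm_coe_unitary_mul, l2_opNorm_diagonal]
  have hprod (s : Finset (Fin n)) : ∏ i ∈ s, hA.isHermitian.eigenvalues i =
      ∏ i ∈ s.map e.symm.toEmbedding, hA.isHermitian.eigenvalues₀ i := by
    rw [Finset.prod_map]; rfl
  have hn : ∀ s : Finset (Fin n), 0 ≤ ∏ i ∈ s, hA.isHermitian.eigenvalues i := fun s ↦
    Finset.prod_nonneg fun i _ ↦ hA.eigenvalues_nonneg i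
  apply le_antisymm
  · refine (pi_norm_le_iff_of_nonneg (Finset.prod_nonneg fun i _ ↦ h0 i)).2 fun s ↦ ?_
    rw [Complex.norm_real, Real.norm_of_nonneg (hn _), hprod]
    refine prod_le_prod_of_antitone hA.isHermitian.eigenvalues₀_antitone h0 ?_
    rw [Finset.card_map]; exact s.2
  · let T : Finset (Fin (Fintype.card (Fin n))) := {i | i.val < j}
    have hT : T.card = j := by
      rw [Fin.card_filter_val_lt, Fintype.card_fin, min_eq_right hj]
    let s : Set.powersetCard (Fin n) j := ⟨T.map e.toEmbedding, by
      change Finset.card _ = _; rw [Finset.card_map, hT]⟩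
    have := norm_le_pi_norm (fun s : Set.powersetCard (Fin n) j ↦
        ((∏ i ∈ (s : Finset (Fin n)), hA.isHermitian.eigenvalues i : ℝ) : ℂ)) s
    rw [Complex.norm_real, Real.norm_of_nonneg (hn _), hprod] at this
    have hs : (s : Finset (Fin n)).map e.symm.toEmbedding = T := by
      change (T.map e.toEmbedding).map e.symm.toEmbedding = T
      ext i; simp [Finset.mem_map_equiv]
    rwa [hs] at this

end Matrix

/-! ### Differentiating the functional calculus at `1`; Lie–Trotter limits. -/

section Limit

open Filter Topology Asymptotics

variable {R : Type*} [CStarAlgebra R]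

/-- The remainder is itself a function of `x`, so the scalar Taylor estimate on the spectrum bounds
its norm. -/
lemma norm_cfc_sub_le {g : ℝ → ℝ} {g' ε δ : ℝ} (hε : 0 ≤ ε) (hgc : ContinuousOn g (Set.Ioi 0))
    (hg : ∀ y, |y - 1| ≤ δ → |g y - g 1 - (y - 1) * g'| ≤ ε * |y - 1|)
    {x : R} (hx : IsSelfAdjoint x) (hx0 : ∀ y ∈ spectrum ℝ x, 0 < y) (hxδ : ‖x - 1‖ ≤ δ) :
    ‖cfc g x - cfc g (1 : R) - g' • (x - 1)‖ ≤ ε * ‖x - 1‖ := by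
  have hc : ContinuousOn g (spectrum ℝ x) := hgc.mono hx0
  have e1 : cfc g (1 : R) = algebraMap ℝ R (g 1) := by
    simp
  have e2 : cfc (fun y : ℝ ↦ y - 1) x = x - 1 := by
    rw [cfc_sub (fun y : ℝ ↦ y) (fun _ ↦ 1) x, cfc_id' ℝ x, cfc_const_one ℝ x]
  have e3 : cfc g x - cfc g (1 : R) - g' • (x - 1) =
      cfc (fun y ↦ g y - g 1 - g' * (y - 1)) x := by
    rw [cfc_sub (fun y ↦ g y - g 1) (fun y ↦ g' * (y - 1)) x,
      cfc_sub (fun y ↦ g y) (fun _ ↦ g 1) x, cfc_const (g 1) x, e1,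
      cfc_const_mul g' (fun y ↦ y - 1) x, e2]
  rw [e3]
  refine norm_cfc_le (by positivity) fun y hy ↦ ?_
  have hy1 : |y - 1| ≤ ‖x - 1‖ := by
    have := norm_apply_le_norm_cfc (fun y : ℝ ↦ y - 1) x hy
    rwa [e2] at this
  rw [Real.norm_eq_abs, mul_comm g']
  exact (hg y (hy1.trans hxδ)).trans (by gcongr)

lemma hasDerivAt_cfc_of_eq_one {g : ℝ → ℝ} {g' : ℝ} (hgc : ContinuousOn g (Set.Ioi 0))
    (hg : HasDerivAt g g' 1) {f : ℝ → R} {l : R} (hf : HasDerivAt f l 0) (hf0 : f 0 = 1)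
    (hsa : ∀ x, IsSelfAdjoint (f x)) (hpos : ∀ x, ∀ y ∈ spectrum ℝ (f x), 0 < y) :
    HasDerivAt (fun x ↦ cfc g (f x)) (g' • l) 0 := by
  have h1 : (fun x ↦ cfc g (f x) - cfc g (1 : R) - g' • (f x - 1)) =o[𝓝 0]
      fun x ↦ f x - 1 := by
    rw [isLittleO_iff]
    intro ε hε
    have h2 := (hasDerivAt_iff_isLittleO.1 hg).def hε
    obtain ⟨δ, hδ, h3⟩ := Metric.eventually_nhds_iff_ball.1 h2
    have hf1 : Tendsto (fun x ↦ ‖f x - 1‖) (𝓝 0) (𝓝 0) := by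
      have := hf.continuousAt.tendsto
      rw [hf0] at this
      simpa using (this.sub_const 1).norm
    filter_upwards [hf1.eventually (ge_mem_nhds (half_pos hδ))] with x hx
    refine norm_cfc_sub_le hε.le hgc (fun y hy ↦ ?_) (hsa x) (hpos x) hx
    have := h3 y (by rw [Metric.mem_ball, Real.dist_eq]; linarith)
    simpa using this
  have h2 : (fun x ↦ f x - 1) =O[𝓝 0] fun x ↦ x - 0 := by
    simpa [hf0] using hf.isBigO_sub
  rw [hasDerivAt_iff_isLittleO]
  have h3 := (h1.trans_isBigO h2).add ((hasDerivAt_iff_isLittleO.1 hf).const_smul_left g')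
  refine h3.congr_left fun x ↦ ?_
  simp only [Pi.smul_apply]
  rw [hf0, smul_sub g' (f x - 1), smul_comm g' (x - 0)]
  abel

variable [PartialOrder R] [StarOrderedRing R] {a b : R}

lemma CFC.rpow_eq_exp (ha : IsStrictlyPositive a) (t : ℝ) :
    a ^ t = NormedSpace.exp (t • CFC.log a) := by
  have hpos : ∀ x ∈ spectrum ℝ a, 0 < x := fun x hx ↦ ha.spectrum_pos hx
  have hc : ContinuousOn Real.log (spectrum ℝ a) :=
    Real.continuousOn_log.mono fun x hx ↦ (hpos x hx).ne'
  have hsa : IsSelfAdjoint a := ha.isSelfAdjoint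
  have e : t • CFC.log a = cfc (fun x ↦ t * Real.log x) a := by
    rw [CFC.log, cfc_const_mul t Real.log a]
  have hsa2 : IsSelfAdjoint (t • CFC.log a) := e ▸ cfc_predicate _ _
  rw [← CFC.real_exp_eq_normedSpace_exp hsa2, e,
    ← cfc_comp' Real.exp (fun x ↦ t * Real.log x) a, CFC.rpow_eq_cfc_real]
  refine cfc_congr fun x hx ↦ ?_
  rw [Real.rpow_def_of_pos (hpos x hx), mul_comm]

lemma CFC.hasDerivAt_rpow_zero (ha : IsStrictlyPositive a) (c : ℝ) :
    HasDerivAt (fun x : ℝ ↦ a ^ (c * x)) (c • CFC.log a) 0 := by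
  have h := hasDerivAt_exp_smul_const (𝕂 := ℝ) (c • CFC.log a) (0 : ℝ)
  rw [zero_smul, NormedSpace.exp_zero, one_mul] at h
  refine h.congr_of_eventuallyEq (Eventually.of_forall fun x ↦ ?_)
  simp only [CFC.rpow_eq_exp ha, smul_smul, mul_comm]

/-- A Lie-Trotter type formula. -/
lemma tendsto_rpow_one_div {f : ℝ → R} {l : R} (hf : HasDerivAt f l 0)
    (hf0 : f 0 = 1) (hpos : ∀ x, IsStrictlyPositive (f x)) :
    Tendsto (fun x ↦ f x ^ (1 / x)) (𝓝[>] 0) (𝓝 (NormedSpace.exp l)) := by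
  have hlog : HasDerivAt Real.log 1 1 := by simpa using Real.hasDerivAt_log one_ne_zero
  have h1 := hasDerivAt_cfc_of_eq_one (Real.continuousOn_log.mono fun x hx ↦ ne_of_gt hx)
    hlog hf hf0 (fun x ↦ (hpos x).isSelfAdjoint) fun x y hy ↦ (hpos x).spectrum_pos hy
  -- `f x ^ (1/x)` is the exponential of the difference quotient of `log ∘ f` at `0`.
  have h3 : Tendsto (fun x ↦ (1 / x) • CFC.log (f x)) (𝓝[>] 0) (𝓝 l) := by
    have h2 := h1.tendsto_slope_zero_right
    rw [one_smul, hf0] at h2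
    refine h2.congr fun x ↦ ?_
    have : cfc Real.log (1 : R) = 0 := CFC.log_one
    rw [zero_add, this, sub_zero, one_div]
    rfl
  let _ : NormedAlgebra ℚ R := NormedAlgebra.restrictScalars ℚ ℂ R
  have h4 := ((NormedSpace.exp_continuous (𝔸 := R)).tendsto l).comp h3
  exact h4.congr fun x ↦ (CFC.rpow_eq_exp (hpos x) _).symm

lemma hasDerivAt_rpow_conj (ha : IsStrictlyPositive a) (hb : IsStrictlyPositive b) (c d : ℝ) :
    HasDerivAt (fun x : ℝ ↦ a ^ (c * x) * b ^ (d * x) * a ^ (c * x))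
      ((2 * c) • CFC.log a + d • CFC.log b) 0 := by
  have h1 := ((CFC.hasDerivAt_rpow_zero ha c).fun_mul (CFC.hasDerivAt_rpow_zero hb d)).fun_mul
    (CFC.hasDerivAt_rpow_zero ha c)
  refine h1.congr_deriv ?_
  simp only [mul_zero, CFC.rpow_zero a ha.nonneg, CFC.rpow_zero b hb.nonneg, one_mul, mul_one]
  module

lemma hasDerivAt_conj_rpow (ha : IsStrictlyPositive a) {f : ℝ → R} {l : R}
    (hf : HasDerivAt f l 0) (hf0 : f 0 = 1) (hpos : ∀ x, IsStrictlyPositive (f x)) (c r : ℝ) :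
    HasDerivAt (fun x : ℝ ↦ a ^ (c * x) * f x ^ r * a ^ (c * x))
      ((2 * c) • CFC.log a + r • l) 0 := by
  have hr : HasDerivAt (fun x : ℝ ↦ x ^ r) r 1 := by
    simpa using Real.hasDerivAt_rpow_const (x := 1) (p := r) (Or.inl one_ne_zero)
  have h0 := hasDerivAt_cfc_of_eq_one
    (fun x hx ↦ (Real.continuousAt_rpow_const x r (Or.inl (ne_of_gt hx))).continuousWithinAt)
    hr hf hf0 (fun x ↦ (hpos x).isSelfAdjoint) fun x y hy ↦ (hpos x).spectrum_pos hy
  have h2 : HasDerivAt (fun x ↦ f x ^ r) (r • l) 0 :=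
    h0.congr_of_eventuallyEq (Eventually.of_forall fun x ↦
      CFC.rpow_eq_cfc_real (hpos x).nonneg)
  have h1 := ((CFC.hasDerivAt_rpow_zero ha c).fun_mul h2).fun_mul (CFC.hasDerivAt_rpow_zero ha c)
  refine h1.congr_deriv ?_
  simp only [mul_zero, CFC.rpow_zero a ha.nonneg, hf0, CFC.one_rpow, one_mul, mul_one]
  module

end Limit

/-! ### Limits of means, and determinants. -/

namespace Matrix

section Limit

open Filter Topology

variable {ι : Type*} [Fintype ι] [DecidableEq ι] {A B : Matrix ι ι ℂ}

lemma PosDef.tendsto_geomMean_rpow (hA : A.PosDef) (hB : B.PosDef) (r : ℝ) :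
    Tendsto (fun x : ℝ ↦ Matrix.geomMean r (A ^ x) (B ^ x) ^ (1 / x)) (𝓝[>] 0)
      (𝓝 (NormedSpace.exp ((1 - r) • CFC.log A + r • CFC.log B))) := by
  have hM (x : ℝ) : IsStrictlyPositive
      (A ^ (-(1 / 2) * x) * B ^ (1 * x) * A ^ (-(1 / 2) * x)) :=
    ((hB.rpow (1 * x)).conj (hA.rpow (-(1 / 2) * x))).isStrictlyPositive
  have h1 := hasDerivAt_conj_rpow hA.isStrictlyPositive
    (hasDerivAt_rpow_conj hA.isStrictlyPositive hB.isStrictlyPositive (-(1 / 2)) 1)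
    (by simp [hA.rpow_zero, hB.rpow_zero]) hM (1 / 2) r
  have h2 := tendsto_rpow_one_div h1 (by simp [hA.rpow_zero, hB.rpow_zero, CFC.one_rpow])
    fun x ↦ (((isStrictlyPositive_iff_posDef.1 (hM x)).rpow r).conj
      (hA.rpow _)).isStrictlyPositive
  have e : (2 * (1 / 2) : ℝ) • CFC.log A + r • ((2 * -(1 / 2) : ℝ) • CFC.log A +
      (1 : ℝ) • CFC.log B) = (1 - r) • CFC.log A + r • CFC.log B := by module
  rw [e] at h2
  refine h2.congr fun x ↦ ?_
  simp only [Matrix.geomMean, hA.rpow_rpow, one_mul, mul_comm x]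

lemma PosDef.tendsto_rpow_conj_rpow (hA : A.PosDef) (hB : B.PosDef) (c d : ℝ) :
    Tendsto (fun x : ℝ ↦ (A ^ (c * x / 2) * B ^ (d * x) * A ^ (c * x / 2)) ^ (1 / x)) (𝓝[>] 0)
      (𝓝 (NormedSpace.exp (c • CFC.log A + d • CFC.log B))) := by
  have h1 := hasDerivAt_rpow_conj hA.isStrictlyPositive hB.isStrictlyPositive (c / 2) d
  have h2 := tendsto_rpow_one_div h1 (by simp [hA.rpow_zero, hB.rpow_zero])
    fun x ↦ ((hB.rpow _).conj (hA.rpow _)).isStrictlyPositive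
  rw [mul_div_cancel₀ c two_ne_zero] at h2
  refine h2.congr fun x ↦ ?_
  simp only [div_mul_eq_mul_div]

end Limit

section LogDet

variable {ι : Type*} [Fintype ι] [DecidableEq ι] {A B X Y : Matrix ι ι ℂ}

/-- The logarithm of the determinant of a positive definite matrix. -/
noncomputable def logDet (A : Matrix ι ι ℂ) : ℝ := Real.log A.det.re

namespace PosDef

lemma det_re_pos (hA : A.PosDef) : 0 < A.det.re := (Complex.lt_def.1 hA.det_pos).1

lemma det_eq_ofReal (hA : A.PosDef) : A.det = (A.det.re : ℂ) :=
  Complex.ext rfl (by simpa using (Complex.lt_def.1 hA.det_pos).2.symm)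

lemma det_eq_of_logDet_eq (hA : A.PosDef) (hB : B.PosDef) (h : logDet A = logDet B) :
    A.det = B.det := by
  rw [hA.det_eq_ofReal, hB.det_eq_ofReal, Real.log_injOn_pos hA.det_re_pos hB.det_re_pos h]

lemma logDet_conj (hX : X.PosDef) (hY : Y.PosDef) :
    logDet (Y * X * Y) = 2 * logDet Y + logDet X := by
  have : (Y * X * Y).det.re = Y.det.re * X.det.re * Y.det.re := by
    rw [det_mul, det_mul, hX.det_eq_ofReal, hY.det_eq_ofReal]
    norm_cast
  have hx := hX.det_re_pos.ne'
  have hy := hY.det_re_pos.ne'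
  rw [logDet, this, Real.log_mul (mul_ne_zero hy hx) hy, Real.log_mul hy hx, logDet, logDet]
  ring

lemma logDet_rpow (hA : A.PosDef) (t : ℝ) : logDet (A ^ t) = t * logDet A := by
  have h1 : (A ^ t).det = ((∏ i, hA.isHermitian.eigenvalues i ^ t : ℝ) : ℂ) := by
    rw [hA.rpow_eq_cfc, hA.isHermitian.cfc_eq, IsHermitian.cfc, Unitary.conjStarAlgAut_apply,
      det_mul_right_comm, show (hA.isHermitian.eigenvectorUnitary : Matrix ι ι ℂ) *
        star (hA.isHermitian.eigenvectorUnitary : Matrix ι ι ℂ) = 1 from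
          Unitary.coe_mul_star_self _, one_mul, det_diagonal]
    simp
  rw [logDet, logDet, h1, hA.isHermitian.det_eq_prod_eigenvalues, Complex.ofReal_re,
    Real.finsetProd_rpow _ _ fun i _ ↦ (hA.eigenvalues_pos i).le,
    Real.log_rpow (Finset.prod_pos fun i _ ↦ hA.eigenvalues_pos i)]
  simp [← Complex.ofReal_prod]

lemma logDet_geomMean (hA : A.PosDef) (hB : B.PosDef) (r : ℝ) :
    logDet (Matrix.geomMean r A B) = (1 - r) * logDet A + r * logDet B := by
  have h := hB.conj (hA.rpow (-(1 / 2)))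
  rw [Matrix.geomMean, (h.rpow _).logDet_conj (hA.rpow _), h.logDet_rpow,
    hB.logDet_conj (hA.rpow _), hA.logDet_rpow, hA.logDet_rpow]
  ring

lemma logDet_spectralGeomMean (hA : A.PosDef) (hB : B.PosDef) (k t : ℝ) :
    logDet (Matrix.spectralGeomMean k t A B) =
      (1 - 2 * k * t) * logDet A + 2 * k * t * logDet B := by
  have h := hA.inv.geomMean hB k
  rw [Matrix.spectralGeomMean, (hA.rpow _).logDet_conj (h.rpow _), h.logDet_rpow,
    hA.inv.logDet_geomMean hB, hA.logDet_rpow, hA.inv_eq_rpow, hA.logDet_rpow]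
  ring

end PosDef

end LogDet

end Matrix

/-! ### The log-majorizations and the main theorem. -/

namespace Matrix

open Filter Topology

section Norm

variable {ι : Type*} [Fintype ι] [DecidableEq ι] {A B : Matrix ι ι ℂ}

lemma PosDef.norm_geomMean_le (hA : A.PosDef) (hB : B.PosDef) {r : ℝ} (hr : 0 < r)
    (hr1 : r ≤ 1) (m : ℕ) :
    ‖Matrix.geomMean r A B‖ ≤ ‖Matrix.geomMean r (A ^ ((1 / 2 : ℝ) ^ m))
      (B ^ ((1 / 2 : ℝ) ^ m))‖ ^ (1 / (1 / 2 : ℝ) ^ m) := by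
  induction m with
  | zero => simp [hA.rpow_one, hB.rpow_one]
  | succ m ih =>
    have h := (hA.rpow ((1 / 2 : ℝ) ^ (m + 1))).norm_geomMean_sq_le
      (hB.rpow ((1 / 2 : ℝ) ^ (m + 1))) hr hr1
    rw [hA.rpow_rpow, hB.rpow_rpow, pow_succ, mul_assoc, one_div_mul_cancel two_ne_zero,
      mul_one] at h
    refine ih.trans ((Real.rpow_le_rpow (norm_nonneg _) h (by positivity)).trans_eq ?_)
    rw [← Real.rpow_mul (norm_nonneg _), pow_succ]
    congr 1
    field_simp

end Norm

variable {n : ℕ} {A B X Y Z : Matrix (Fin n) (Fin n) ℂ}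

lemma PosSemidef.logMajorizedBy (hX : X.PosSemidef) (hY : Y.PosSemidef)
    (h : ∀ j, ‖compound j X‖ ≤ ‖compound j Y‖) (hdet : X.det = Y.det) : X ≺ₗₒ Y := by
  refine ⟨⟨hX, hY, fun j _ hj ↦ ?_⟩, hdet⟩
  rw [Fintype.card_fin] at hj
  rw [← hX.norm_compound hj, ← hY.norm_compound hj]
  exact h j

lemma PosDef.logMajorizedBy (hX : X.PosDef) (hY : Y.PosDef)
    (h : ∀ j, ‖Matrix.compound j X‖ ≤ ‖Matrix.compound j Y‖) (hdet : logDet X = logDet Y) :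
    X ≺ₗₒ Y :=
  hX.posSemidef.logMajorizedBy hY.posSemidef h (hX.det_eq_of_logDet_eq hY hdet)

namespace LogMajorizedBy

/-- Converse of `PosSemidef.logMajorizedBy`: the resulting characterization by norms gives
transitivity and stability under limits. -/
lemma norm_compound_le (h : X ≺ₗₒ Y) (j : ℕ) : ‖compound j X‖ ≤ ‖compound j Y‖ := by
  obtain ⟨⟨hX, hY, h⟩, -⟩ := h
  rcases le_or_gt j n with hj | hj
  · rw [hX.norm_compound hj, hY.norm_compound hj]
    rcases Nat.eq_zero_or_pos j with rfl | hj0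
    · simp
    · exact h j hj0 (by rwa [Fintype.card_fin])
  -- There are no `j`-subsets for `j > n`, so both compounds are empty matrices.
  · have : IsEmpty (Set.powersetCard (Fin n) j) :=
      ⟨fun s ↦ by
        have h1 : (s : Finset (Fin n)).card = j := s.2
        have h2 := Finset.card_le_univ (s : Finset (Fin n))
        rw [h1, Fintype.card_fin] at h2
        omega⟩
    exact (congrArg norm (Subsingleton.elim _ _)).le

lemma trans (h1 : X ≺ₗₒ Y) (h2 : Y ≺ₗₒ Z) : X ≺ₗₒ Z :=
  PosSemidef.logMajorizedBy h1.1.choose h2.1.choose_spec.choose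
    (fun j ↦ (h1.norm_compound_le j).trans (h2.norm_compound_le j)) (h1.2.trans h2.2)

variable {α : Type*} {l : Filter α} [l.NeBot] {f : α → Matrix (Fin n) (Fin n) ℂ}

lemma of_tendsto_right (hX : X.PosSemidef) (hY : Y.PosSemidef) (hf : Tendsto f l (𝓝 Y))
    (h : ∀ᶠ a in l, X ≺ₗₒ f a) : X ≺ₗₒ Y := by
  refine hX.logMajorizedBy hY (fun j ↦ ?_) ?_
  · exact ge_of_tendsto (((continuous_compound j).tendsto Y).comp hf).norm
      (h.mono fun a ha ↦ ha.norm_compound_le j)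
  · exact tendsto_nhds_unique (tendsto_const_nhds.congr' (h.mono fun a ha ↦ ha.2))
      ((continuous_id.matrix_det.tendsto Y).comp hf)

lemma of_tendsto_left (hX : X.PosSemidef) (hY : Y.PosSemidef) (hf : Tendsto f l (𝓝 X))
    (h : ∀ᶠ a in l, f a ≺ₗₒ Y) : X ≺ₗₒ Y := by
  refine hX.logMajorizedBy hY (fun j ↦ ?_) ?_
  · exact le_of_tendsto (((continuous_compound j).tendsto X).comp hf).norm
      (h.mono fun a ha ↦ ha.norm_compound_le j)
  · exact tendsto_nhds_unique ((continuous_id.matrix_det.tendsto X).comp hf)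
      (tendsto_const_nhds.congr' (h.mono fun a ha ↦ ha.2.symm))

end LogMajorizedBy

lemma posSemidef_exp_smul_log_add (A B : Matrix (Fin n) (Fin n) ℂ) (c d : ℝ) :
    (NormedSpace.exp (c • CFC.log A + d • CFC.log B)).PosSemidef := by
  have h : IsSelfAdjoint (c • CFC.log A + d • CFC.log B) :=
    ((IsSelfAdjoint.all c).smul .log).add ((IsSelfAdjoint.all d).smul .log)
  exact nonneg_iff_posSemidef.1 h.exp_nonneg

namespace PosDef

/-- The two bases are `Z Zᴴ` and `Zᴴ Z` for `Z = A^a B^{b/2}`. -/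
lemma logMajorizedBy_rpow_conj_comm (hA : A.PosDef) (hB : B.PosDef) {a b a' b' s : ℝ}
    (hs : 0 < s) (ha : a' = 2 * a) (hb : b' = b / 2) :
    (A ^ a * B ^ b * A ^ a) ^ s ≺ₗₒ (B ^ b' * A ^ a' * B ^ b') ^ s := by
  have h1 := (hB.rpow b).conj (hA.rpow a)
  have h2 := (hA.rpow a').conj (hB.rpow b')
  subst ha hb
  refine (h1.rpow s).logMajorizedBy (h2.rpow s) (fun j ↦ ?_) ?_
  · rw [h1.compound_rpow, h2.compound_rpow, (h1.compound j).norm_rpow hs,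
      (h2.compound j).norm_rpow hs]
    have hZ := norm_mul_conjTranspose_comm (Matrix.compound j (A ^ a * B ^ (b / 2)))
    have e : (A ^ a * B ^ (b / 2))ᴴ = B ^ (b / 2) * A ^ a := by
      rw [conjTranspose_mul, (hA.rpow _).isHermitian.eq, (hB.rpow _).isHermitian.eq]
    have e1 : A ^ a * B ^ b * A ^ a = A ^ a * B ^ (b / 2) * (B ^ (b / 2) * A ^ a) := by
      rw [← mul_assoc, mul_assoc (A ^ a) (B ^ (b / 2)), ← hB.rpow_add, add_halves]
    have e2 : B ^ (b / 2) * A ^ (2 * a) * B ^ (b / 2) =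
        B ^ (b / 2) * A ^ a * (A ^ a * B ^ (b / 2)) := by
      rw [← mul_assoc, mul_assoc (B ^ (b / 2)) (A ^ a), ← hA.rpow_add, two_mul]
    rw [← compound_conjTranspose, ← compound_mul, ← compound_mul, e] at hZ
    rw [e1, e2, hZ]
  · rw [h1.logDet_rpow, h2.logDet_rpow, (hB.rpow b).logDet_conj (hA.rpow a),
      (hA.rpow _).logDet_conj (hB.rpow _), hA.logDet_rpow, hA.logDet_rpow, hB.logDet_rpow,
      hB.logDet_rpow]
    ring

/-- The Ando-Hiai log-majorization. -/
lemma geomMean_logMajorizedBy_exp (hA : A.PosDef) (hB : B.PosDef) {r : ℝ} (hr : 0 < r)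
    (hr1 : r ≤ 1) :
    Matrix.geomMean r A B ≺ₗₒ NormedSpace.exp ((1 - r) • CFC.log A + r • CFC.log B) := by
  -- Iterated squaring reaches only the exponents `2^{-m}`, which suffice for the limit.
  have hq : Tendsto (fun m : ℕ ↦ (1 / 2 : ℝ) ^ m) atTop (𝓝[>] 0) :=
    tendsto_nhdsWithin_iff.2 ⟨tendsto_pow_atTop_nhds_zero_of_lt_one (by norm_num) (by norm_num),
      Eventually.of_forall fun m ↦ by simp⟩
  refine LogMajorizedBy.of_tendsto_right (hA.geomMean hB r).posSemidef
    (posSemidef_exp_smul_log_add A B _ _) ((hA.tendsto_geomMean_rpow hB r).comp hq)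
    (Eventually.of_forall fun m ↦ ?_)
  have hq0 : 0 < (1 / 2 : ℝ) ^ m := by positivity
  have hG := (hA.rpow ((1 / 2 : ℝ) ^ m)).geomMean (hB.rpow ((1 / 2 : ℝ) ^ m)) r
  simp only [Function.comp_apply]
  refine (hA.geomMean hB r).logMajorizedBy (hG.rpow _) (fun j ↦ ?_) ?_
  · rw [hG.compound_rpow, (hG.compound j).norm_rpow (by positivity),
      (hA.rpow _).compound_geomMean (hB.rpow _), hA.compound_geomMean hB, hA.compound_rpow,
      hB.compound_rpow]
    exact (hA.compound j).norm_geomMean_le (hB.compound j) hr hr1 m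
  · rw [hG.logDet_rpow, (hA.rpow _).logDet_geomMean (hB.rpow _), hA.logDet_geomMean hB,
      hA.logDet_rpow, hB.logDet_rpow]
    field_simp

/-- Araki's log-majorization. -/
lemma rpow_conj_logMajorizedBy (hA : A.PosDef) (hB : B.PosDef) (c d : ℝ) {q p : ℝ} (hq : 0 < q)
    (hqp : q ≤ p) :
    (A ^ (c * q / 2) * B ^ (d * q) * A ^ (c * q / 2)) ^ (1 / q) ≺ₗₒ
      (A ^ (c * p / 2) * B ^ (d * p) * A ^ (c * p / 2)) ^ (1 / p) := by
  have hp : 0 < p := hq.trans_le hqp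
  have h1 := (hB.rpow (d * q)).conj (hA.rpow (c * q / 2))
  have h2 := (hB.rpow (d * p)).conj (hA.rpow (c * p / 2))
  refine (h1.rpow _).logMajorizedBy (h2.rpow _) (fun j ↦ ?_) ?_
  · have hCA := hA.compound j
    have hCB := hB.compound j
    rw [h1.compound_rpow, h2.compound_rpow, (h1.compound j).norm_rpow (by positivity),
      (h2.compound j).norm_rpow (by positivity)]
    simp only [compound_mul, hA.compound_rpow, hB.compound_rpow]
    have h := (hCB.rpow (d * q)).norm_conj_le (hCA.rpow (c * q / 2)) (q := p / q)
      ((one_le_div hq).2 hqp)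
    rw [hCB.rpow_rpow, hCA.rpow_rpow, show d * q * (p / q) = d * p by field_simp,
      show c * q / 2 * (p / q) = c * p / 2 by field_simp] at h
    refine (Real.rpow_le_rpow (norm_nonneg _) h (by positivity)).trans_eq ?_
    rw [← Real.rpow_mul (norm_nonneg _)]
    congr 1
    field_simp
  · rw [h1.logDet_rpow, h2.logDet_rpow, (hB.rpow _).logDet_conj (hA.rpow _),
      (hB.rpow _).logDet_conj (hA.rpow _), hA.logDet_rpow, hA.logDet_rpow, hB.logDet_rpow,
      hB.logDet_rpow]
    field_simp

lemma exp_logMajorizedBy_rpow_conj (hA : A.PosDef) (hB : B.PosDef) (c d : ℝ) {p : ℝ}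
    (hp : 0 < p) :
    NormedSpace.exp (c • CFC.log A + d • CFC.log B) ≺ₗₒ
      (A ^ (c * p / 2) * B ^ (d * p) * A ^ (c * p / 2)) ^ (1 / p) := by
  refine LogMajorizedBy.of_tendsto_left (posSemidef_exp_smul_log_add A B c d)
    (((hB.rpow _).conj (hA.rpow _)).rpow _).posSemidef (hA.tendsto_rpow_conj_rpow hB c d) ?_
  filter_upwards [Ioc_mem_nhdsGT hp] with q hq
  exact hA.rpow_conj_logMajorizedBy hB c d hq.1 hq.2

variable {k t : ℝ}

lemma rpow_conj_logMajorizedBy_spectralGeomMean (hA : A.PosDef) (hB : B.PosDef)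
    (hk : 0 < k) (hk2 : k ≤ 1 / 2) (ht : 0 < t) (ht2 : t ≤ 1 / 2) {p : ℝ} (hp : 0 < p) :
    (A ^ (p / 2) * B ^ (2 * k * t * p / (1 - 2 * k * t)) * A ^ (p / 2)) ^
        ((1 - 2 * k * t) / p) ≺ₗₒ
      Matrix.spectralGeomMean k t (A ^ p) (B ^ p) ^ (1 / p) := by
  have hr : 0 < 1 - 2 * k * t := by nlinarith
  have h1 := (hB.rpow (2 * k * t * p / (1 - 2 * k * t))).conj (hA.rpow (p / 2))
  have h2 := (hA.rpow p).spectralGeomMean (hB.rpow p) k t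
  refine (h1.rpow _).logMajorizedBy (h2.rpow _) (fun j ↦ ?_) ?_
  · have hCA := hA.compound j
    have hCB := hB.compound j
    rw [h1.compound_rpow, h2.compound_rpow, (h1.compound j).norm_rpow (by positivity),
      (h2.compound j).norm_rpow (by positivity),
      (hA.rpow p).compound_spectralGeomMean (hB.rpow p)]
    simp only [compound_mul, hA.compound_rpow, hB.compound_rpow]
    have h := (hCA.rpow p).norm_conj_le_spectralGeomMean (hCB.rpow p) hk hk2 ht ht2
    rw [hCA.rpow_rpow, hCB.rpow_rpow, mul_one_div, mul_div_assoc', mul_comm p] at h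
    refine (Real.rpow_le_rpow (norm_nonneg _) h (by positivity)).trans_eq ?_
    rw [← Real.rpow_mul (norm_nonneg _)]
    congr 1
    field_simp
  · rw [h1.logDet_rpow, h2.logDet_rpow, (hB.rpow _).logDet_conj (hA.rpow _),
      (hA.rpow p).logDet_spectralGeomMean (hB.rpow p), hA.logDet_rpow, hA.logDet_rpow,
      hB.logDet_rpow, hB.logDet_rpow]
    field_simp

lemma spectralGeomMean_logMajorizedBy_rpow_conj (hA : A.PosDef) (hB : B.PosDef)
    (hk : 0 < k) (hk2 : k ≤ 1 / 2) (ht : 0 < t) (ht2 : t ≤ 1 / 2) {p : ℝ} (hp : 0 < p) :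
    Matrix.spectralGeomMean k t (A ^ p) (B ^ p) ^ (1 / p) ≺ₗₒ
      (A ^ ((1 - 2 * k * t) * p / (4 * k * t)) * B ^ p *
        A ^ ((1 - 2 * k * t) * p / (4 * k * t))) ^ (2 * k * t / p) := by
  have h1 := (hA.rpow p).spectralGeomMean (hB.rpow p) k t
  have h2 := (hB.rpow p).conj (hA.rpow ((1 - 2 * k * t) * p / (4 * k * t)))
  refine (h1.rpow _).logMajorizedBy (h2.rpow _) (fun j ↦ ?_) ?_
  · have hCA := hA.compound j
    have hCB := hB.compound j
    rw [h1.compound_rpow, h2.compound_rpow, (h1.compound j).norm_rpow (by positivity),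
      (h2.compound j).norm_rpow (by positivity),
      (hA.rpow p).compound_spectralGeomMean (hB.rpow p)]
    simp only [compound_mul, hA.compound_rpow, hB.compound_rpow]
    have h := (hCA.rpow p).norm_spectralGeomMean_le (hCB.rpow p) hk hk2 ht ht2
    rw [hCA.rpow_rpow, mul_div_assoc', mul_comm p] at h
    refine (Real.rpow_le_rpow (norm_nonneg _) h (by positivity)).trans_eq ?_
    rw [← Real.rpow_mul (norm_nonneg _)]
    congr 1
    field_simp
  · rw [h1.logDet_rpow, h2.logDet_rpow, (hB.rpow _).logDet_conj (hA.rpow _),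
      (hA.rpow p).logDet_spectralGeomMean (hB.rpow p), hA.logDet_rpow, hA.logDet_rpow,
      hB.logDet_rpow]
    field_simp
    ring

/-- Araki's inequality between the exponents `p` and `p/(1-r)`. -/
lemma rpow_conj_logMajorizedBy_rpow_conj_div (hA : A.PosDef) (hB : B.PosDef) {r : ℝ}
    (hr : 0 ≤ r) (hr1 : r < 1) {p : ℝ} (hp : 0 < p) :
    (A ^ ((1 - r) * p / 2) * B ^ (r * p) * A ^ ((1 - r) * p / 2)) ^ (1 / p) ≺ₗₒ
      (A ^ (p / 2) * B ^ (r * p / (1 - r)) * A ^ (p / 2)) ^ ((1 - r) / p) := by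
  have hr' : 0 < 1 - r := by linarith
  have h := hA.rpow_conj_logMajorizedBy hB (1 - r) r hp (p := p / (1 - r))
    ((le_div_iff₀ hr').2 (by nlinarith))
  rwa [mul_div_cancel₀ _ hr'.ne', mul_div_assoc', one_div_div] at h

end PosDef

end Matrix

theorem mainTheorem5 (n : ℕ) (A B : Matrix (Fin n) (Fin n) ℂ) (hA : A.PosDef) (hB : B.PosDef)
    (k t : ℝ) :
    (0 < k → k ≤ 1 / 2 → 0 < t → t ≤ 1 / 2 → ∀ p : ℝ, 0 < p →
      Matrix.geomMean (2 * k * t) A B ≺ₗₒ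
          NormedSpace.exp ((1 - 2 * k * t) • CFC.log A + (2 * k * t) • CFC.log B) ∧
      NormedSpace.exp ((1 - 2 * k * t) • CFC.log A + (2 * k * t) • CFC.log B) ≺ₗₒ
          (A ^ ((1 - 2 * k * t) * p / 2) * B ^ (2 * k * t * p) *
            A ^ ((1 - 2 * k * t) * p / 2)) ^ (1 / p) ∧
      (A ^ ((1 - 2 * k * t) * p / 2) * B ^ (2 * k * t * p) *
            A ^ ((1 - 2 * k * t) * p / 2)) ^ (1 / p) ≺ₗₒ
          (A ^ (p / 2) * B ^ (2 * k * t * p / (1 - 2 * k * t)) * A ^ (p / 2)) ^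
            ((1 - 2 * k * t) / p) ∧
      (A ^ (p / 2) * B ^ (2 * k * t * p / (1 - 2 * k * t)) * A ^ (p / 2)) ^
            ((1 - 2 * k * t) / p) ≺ₗₒ
          Matrix.spectralGeomMean k t (A ^ p) (B ^ p) ^ (1 / p) ∧
      Matrix.spectralGeomMean k t (A ^ p) (B ^ p) ^ (1 / p) ≺ₗₒ
          (A ^ ((1 - 2 * k * t) * p / (4 * k * t)) * B ^ p *
            A ^ ((1 - 2 * k * t) * p / (4 * k * t))) ^ (2 * k * t / p)) ∧
    (1 / 2 ≤ k → k < 1 → 1 / 2 ≤ t → t < 1 → ∀ p : ℝ, 0 < p →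
      Matrix.geomMean (2 * (1 - k) * (1 - t)) B A ≺ₗₒ
          NormedSpace.exp ((2 * (1 - k) * (1 - t)) • CFC.log A +
            (1 - 2 * (1 - k) * (1 - t)) • CFC.log B) ∧
      NormedSpace.exp ((2 * (1 - k) * (1 - t)) • CFC.log A +
            (1 - 2 * (1 - k) * (1 - t)) • CFC.log B) ≺ₗₒ
          (A ^ ((1 - k) * (1 - t) * p) * B ^ ((1 - 2 * (1 - k) * (1 - t)) * p) *
            A ^ ((1 - k) * (1 - t) * p)) ^ (1 / p) ∧
      (A ^ ((1 - k) * (1 - t) * p) * B ^ ((1 - 2 * (1 - k) * (1 - t)) * p) *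
            A ^ ((1 - k) * (1 - t) * p)) ^ (1 / p) ≺ₗₒ
          (A ^ ((1 - k) * (1 - t) * p / (1 - 2 * (1 - k) * (1 - t))) * B ^ p *
            A ^ ((1 - k) * (1 - t) * p / (1 - 2 * (1 - k) * (1 - t)))) ^
            ((1 - 2 * (1 - k) * (1 - t)) / p) ∧
      (A ^ ((1 - k) * (1 - t) * p / (1 - 2 * (1 - k) * (1 - t))) * B ^ p *
            A ^ ((1 - k) * (1 - t) * p / (1 - 2 * (1 - k) * (1 - t)))) ^
            ((1 - 2 * (1 - k) * (1 - t)) / p) ≺ₗₒ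
          Matrix.spectralGeomMean (1 - k) (1 - t) (B ^ p) (A ^ p) ^ (1 / p) ∧
      Matrix.spectralGeomMean (1 - k) (1 - t) (B ^ p) (A ^ p) ^ (1 / p) ≺ₗₒ
          (A ^ (p / 2) * B ^ ((1 - 2 * (1 - k) * (1 - t)) * p / (2 * (1 - k) * (1 - t))) *
            A ^ (p / 2)) ^ (2 * (1 - k) * (1 - t) / p)) := by
  refine ⟨fun hk hk2 ht ht2 p hp ↦ ?_, fun hk hk1 ht ht1 p hp ↦ ?_⟩
  · have hr : 0 < 2 * k * t := by positivity
    have hr1 : 2 * k * t < 1 := by nlinarith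
    exact ⟨hA.geomMean_logMajorizedBy_exp hB hr hr1.le,
      hA.exp_logMajorizedBy_rpow_conj hB _ _ hp,
      hA.rpow_conj_logMajorizedBy_rpow_conj_div hB hr.le hr1 hp,
      hA.rpow_conj_logMajorizedBy_spectralGeomMean hB hk hk2 ht ht2 hp,
      hA.spectralGeomMean_logMajorizedBy_rpow_conj hB hk hk2 ht ht2 hp⟩
  · have hk' : 0 < 1 - k := by linarith
    have hk2' : 1 - k ≤ 1 / 2 := by linarith
    have ht' : 0 < 1 - t := by linarith
    have ht2' : 1 - t ≤ 1 / 2 := by linarith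
    have hr : 0 < 2 * (1 - k) * (1 - t) := by positivity
    have hr1 : 2 * (1 - k) * (1 - t) < 1 := by nlinarith
    have hr2 : 0 < 1 - 2 * (1 - k) * (1 - t) := by linarith
    -- Part (1) with `A` and `B` exchanged puts `B` outside; `logMajorizedBy_rpow_conj_comm` then
    -- brings `A` outside.
    have h2 := hB.exp_logMajorizedBy_rpow_conj hA (1 - 2 * (1 - k) * (1 - t))
      (2 * (1 - k) * (1 - t)) hp
    have h3 := hB.rpow_conj_logMajorizedBy_rpow_conj_div hA hr.le hr1 hp
    have h4 := hB.rpow_conj_logMajorizedBy_spectralGeomMean hA hk' hk2' ht' ht2' hp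
    have h5 := hB.spectralGeomMean_logMajorizedBy_rpow_conj hA hk' hk2' ht' ht2' hp
    refine ⟨?_, ?_, ?_, ?_, ?_⟩
    · rw [add_comm]
      exact hB.geomMean_logMajorizedBy_exp hA hr hr1.le
    · rw [add_comm]
      exact h2.trans (hB.logMajorizedBy_rpow_conj_comm hA (by positivity) (by ring) (by ring))
    · exact ((hA.logMajorizedBy_rpow_conj_comm hB (by positivity) (by ring) (by ring)).trans
        h3).trans (hB.logMajorizedBy_rpow_conj_comm hA (by positivity) (by ring) (by ring))
    · exact (hA.logMajorizedBy_rpow_conj_comm hB (by positivity) (by ring) (by ring)).trans h4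
    · exact h5.trans (hB.logMajorizedBy_rpow_conj_comm hA (by positivity)
        (by field_simp; ring) (by ring))
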